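/- Let $k$ be a normed field whose norm extends the usual absolute value of $\mathbb{Q}$ (for example $\mathbb{Q}$, $\mathbb{R}$ or $\mathbb{C}$). For $n\ge 2$ let $L[x_1,\ldots,x_n]$ be the completed free Lie algebra over $k$ on $x_1,\ldots,x_n$: formal series in the non-commuting indeterminates $x_1,\ldots,x_n$ whose part with at most $K$ Lie brackets (that is, of degree at most $K+1$; this part is called the truncation to $\le K$ brackets) is, for every $K\ge 0$, an element of the free Lie algebra on $x_1,\ldots,x_n$, viewed inside the algebra of non-commutative polynomials with the commutator bracket. An element $\mu$ of it is totally symmetric if $\mu(x_{\sigma(1)},\ldots,x_{\sigma(n)})=\mu(x_1,\ldots,x_n)$ for all permutations $\sigma$ of $\{1,\ldots,n\}$. Let $\mathrm{BCH}(x,y)=\log(\exp x\cdot\exp y)$ and $\mu_2(x_1,x_2)=\mathrm{BCH}\big(x_1,\tfrac12\mathrm{BCH}(-x_1,x_2)\big)$. **Lemma 4.1.** There is a unique sequence of totally symmetric elements $\mu_n\in L[x_1,\ldots,x_n]$, $n>2$, such that for each $n>2$ the $n$ sequences $(x_1^t)_{t\ge0},\ldots,(x_n^t)_{t\ge0}$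 defined iteratively by $$x_i^{t+1}=\mu_{n-1}(x_1^t,\ldots,\widehat{x_i^t},\ldots,x_n^t),\qquad x_i^0=x_i,\qquad 1\le i\le n,$$ where $\widehat{x_i^t}$ means that this argument is omitted, all converge to $\mu_n$ as $t\to\infty$, in the sense that for every $K\ge 0$ their truncations to $\le K$ Lie brackets converge (coefficientwise) to that of $\mu_n$. The part of $\mu_n$ without Lie brackets is $\frac1n(x_1+\cdots+x_n)$. -/

import Mathlib

open Filter Topology

noncomputable section

/-- Formal power series in the non-commuting indeterminates `X` with coefficients in `R`:
a series is given by its coefficient at each word in the alphabet `X`. -/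
def NCSeries (R : Type*) (X : Type*) : Type _ := List X → R

namespace NCSeries

@[ext] protected theorem ext {R X : Type*} {f g : NCSeries R X} (h : ∀ w, f w = g w) : f = g :=
  funext h

section Ring

variable {R X : Type*} [CommRing R]

instance : AddCommGroup (NCSeries R X) := inferInstanceAs (AddCommGroup (List X → R))

instance : Module R (NCSeries R X) := inferInstanceAs (Module R (List X → R))

/-- The constant series `1`. -/
instance : One (NCSeries R X) := ⟨fun w => if w.length = 0 then 1 else 0⟩

/-- The concatenation product: the coefficient of `f * g` at `w` is the sum of `f u * g v` over
all factorizations `w = u v`. -/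
instance : Mul (NCSeries R X) :=
  ⟨fun f g w => ∑ i ∈ Finset.range (w.length + 1), f (w.take i) * g (w.drop i)⟩

theorem add_apply (f g : NCSeries R X) (w : List X) : (f + g) w = f w + g w := rfl

theorem zero_apply (w : List X) : (0 : NCSeries R X) w = 0 := rfl

theorem smul_apply (c : R) (f : NCSeries R X) (w : List X) : (c • f) w = c * f w := rfl

theorem one_apply (w : List X) : (1 : NCSeries R X) w = if w.length = 0 then 1 else 0 := rfl

theorem mul_apply (f g : NCSeries R X) (w : List X) :
    (f * g) w = ∑ i ∈ Finset.range (w.length + 1), f (w.take i) * g (w.drop i) := rfl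

theorem mul_nil (f g : NCSeries R X) : (f * g) [] = f [] * g [] := by
  simp [mul_apply]

/-- The left quotient of a series by a letter `a`, with coefficient `f (a u)` at `u`. -/
def leftQuot (a : X) (f : NCSeries R X) : NCSeries R X := fun u => f (a :: u)

theorem mul_cons (f g : NCSeries R X) (a : X) (w : List X) :
    (f * g) (a :: w) = f [] * g (a :: w) + (leftQuot a f * g) w := by
  rw [mul_apply, List.length_cons, Finset.sum_range_succ']
  simp only [List.take_succ_cons, List.drop_succ_cons, List.take_zero, List.drop_zero]
  rw [add_comm, mul_apply]
  rfl

protected theorem add_mul' (f g h : NCSeries R X) : (f + g) * h = f * h + g * h := by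
  ext w
  simp only [mul_apply, add_apply, add_mul, Finset.sum_add_distrib]

protected theorem mul_add' (f g h : NCSeries R X) : f * (g + h) = f * g + f * h := by
  ext w
  simp only [mul_apply, add_apply, mul_add, Finset.sum_add_distrib]

protected theorem smul_mul' (c : R) (f g : NCSeries R X) : (c • f) * g = c • (f * g) := by
  ext w
  simp only [mul_apply, smul_apply, Finset.mul_sum, mul_assoc]

protected theorem mul_smul' (c : R) (f g : NCSeries R X) : f * (c • g) = c • (f * g) := by
  ext w
  simp only [mul_apply, smul_apply, Finset.mul_sum]
  exact Finset.sum_congr rfl fun _ _ => by ring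

protected theorem mul_assoc' (f g h : NCSeries R X) : f * g * h = f * (g * h) := by
  ext w
  induction w generalizing f with
  | nil => simp only [mul_nil, mul_assoc]
  | cons a w ih =>
    have e : leftQuot a (f * g) = f [] • leftQuot a g + leftQuot a f * g := by
      ext u
      exact mul_cons f g a u
    rw [mul_cons (f * g), e, mul_cons f, NCSeries.add_mul', add_apply, ih, mul_nil,
      NCSeries.smul_mul', smul_apply, mul_cons g]
    ring

protected theorem one_mul' (f : NCSeries R X) : 1 * f = f := by
  ext w
  rw [mul_apply, Finset.sum_eq_single 0]
  · simp [one_apply]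
  · intro i hi h0
    have hi' := Finset.mem_range.1 hi
    rw [one_apply, if_neg, zero_mul]
    rw [List.length_take]
    omega
  · simp

protected theorem mul_one' (f : NCSeries R X) : f * 1 = f := by
  ext w
  rw [mul_apply, Finset.sum_eq_single w.length]
  · simp [one_apply]
  · intro i hi h0
    have hi' := Finset.mem_range.1 hi
    rw [one_apply, if_neg, mul_zero]
    rw [List.length_drop]
    omega
  · simp

/-- The ring of non-commutative formal power series. -/
instance : Ring (NCSeries R X) :=
  { (inferInstance : AddCommGroup (NCSeries R X)),
    (inferInstance : One (NCSeries R X)),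
    (inferInstance : Mul (NCSeries R X)) with
    left_distrib := NCSeries.mul_add'
    right_distrib := NCSeries.add_mul'
    zero_mul := fun f => by ext w; simp [mul_apply, zero_apply]
    mul_zero := fun f => by ext w; simp [mul_apply, zero_apply]
    mul_assoc := NCSeries.mul_assoc'
    one_mul := NCSeries.one_mul'
    mul_one := NCSeries.mul_one' }

instance : Algebra R (NCSeries R X) :=
  Algebra.ofModule NCSeries.smul_mul' NCSeries.mul_smul'

/-- The Lie bracket is the commutator. -/
instance : LieRing (NCSeries R X) := LieRing.ofAssociativeRing

instance : LieAlgebra R (NCSeries R X) := LieAlgebra.ofAssociativeAlgebra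

theorem lie_def (f g : NCSeries R X) : ⁅f, g⁆ = f * g - g * f := rfl

open Classical in
/-- The indeterminate `x`, as a series. -/
def letter (x : X) : NCSeries R X := fun w => if w = [x] then 1 else 0

/-- The truncation which keeps exactly the part with at most `K` Lie brackets: a Lie monomial with
`r` brackets is a homogeneous polynomial of degree `r + 1` in the indeterminates, so this is the
part supported on words of length at most `K + 1`. -/
def trunc (K : ℕ) (f : NCSeries R X) : NCSeries R X :=
  fun w => if w.length ≤ K + 1 then f w else 0

variable (R X) in
/-- The canonical Lie algebra homomorphism, sending generators to indeterminates, from the free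
Lie algebra on `X` to the non-commutative series with the commutator bracket. -/
def ofFreeLie : FreeLieAlgebra R X →ₗ⁅R⁆ NCSeries R X :=
  FreeLieAlgebra.lift R (letter : X → NCSeries R X)

/-- `f` belongs to the completed free Lie algebra on `X` (formal infinite sums of Lie polynomials
with increasing numbers of brackets): each of its truncations is an element of the free Lie
algebra on `X`, viewed as usual inside its universal enveloping algebra, the algebra of
non-commutative polynomials. In particular `f` has no constant term. -/
def IsLie (f : NCSeries R X) : Prop :=
  ∀ K : ℕ, trunc K f ∈ (ofFreeLie R X).range

/-- Substitution `g(a)` of the series `a x` for the indeterminates `x` in the series `g`, that is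
`∑_w g(w) a(w₁) ⋯ a(wⱼ)`, the sum being over all words `w = w₁ ⋯ wⱼ`. This is meant for `a x`
without constant term, so that only words `w` with `j ≤ |v|` contribute to the coefficient
at `v`. -/
def subst {Y : Type*} [Fintype X] (a : X → NCSeries R Y) (g : NCSeries R X) : NCSeries R Y :=
  fun v => ∑ j ∈ Finset.range (v.length + 1), ∑ w : Fin j → X,
    g (List.ofFn w) * ((List.ofFn w).map a).prod v

end Ring

section Topology

variable {R X : Type*} [TopologicalSpace R]

/-- The topology of coefficientwise convergence. For a finite alphabet it induces on the
finite-dimensional space of elements with at most `K` brackets its usual topology. -/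
instance : TopologicalSpace (NCSeries R X) := inferInstanceAs (TopologicalSpace (List X → R))

end Topology

section BCH

variable {k X : Type*} [Field k]

/-- The sum `∑_{m ≥ 0} c m • f ^ m`, for a series `f` without constant term (so that only
`m ≤ |w|` contributes to the coefficient at `w`). -/
def powSum (c : ℕ → k) (f : NCSeries k X) : NCSeries k X :=
  fun w => ∑ m ∈ Finset.range (w.length + 1), c m * (f ^ m) w

/-- `exp f = ∑_{m ≥ 0} f ^ m / m!`, for `f` without constant term. -/
def exp (f : NCSeries k X) : NCSeries k X := powSum (fun m => 1 / (m.factorial : k)) f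

/-- `log f = ∑_{m ≥ 1} (-1) ^ (m + 1) (f - 1) ^ m / m`, for `f` with constant term `1`. -/
def log (f : NCSeries k X) : NCSeries k X :=
  powSum (fun m => if m = 0 then 0 else (-1) ^ (m + 1) / (m : k)) (f - 1)

/-- The Baker-Campbell-Hausdorff series, `exp (bch f g) = exp f * exp g`. -/
def bch (f g : NCSeries k X) : NCSeries k X := log (exp f * exp g)

end BCH

end NCSeries

open NCSeries

/-- The universal average of two elements, `μ₂(x, y) = BCH(x, ½ BCH(-x, y))`. -/
def mu2 (k : Type*) [Field k] : NCSeries k (Fin 2) :=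
  bch (letter 0) ((1 / 2 : k) • bch (-letter 0) (letter 1))

/-- The sequences `(x_i^t)_t`, for `i` ranging over `N + 1` indices, obtained from an average
`μ` of `N` elements: `x_i^0 = x_i`, and `x_i^{t+1}` is `μ` evaluated at the `N` elements
`x_j^t`, `j ≠ i`, in increasing order of `j`. -/
def avgSeq {k : Type*} [Field k] {N : ℕ} (μ : NCSeries k (Fin N)) :
    ℕ → Fin (N + 1) → NCSeries k (Fin (N + 1))
  | 0 => letter
  | t + 1 => fun i => subst (fun j => avgSeq μ t (i.succAbove j)) μ

/-- Total symmetry: `μ(x_{σ 1}, …, x_{σ N}) = μ(x_1, …, x_N)` for every permutation `σ`. -/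
def IsTotallySymmetric {k : Type*} [Field k] {N : ℕ} (μ : NCSeries k (Fin N)) : Prop :=
  ∀ σ : Equiv.Perm (Fin N), subst (fun i => letter (σ i)) μ = μ

/-- Convergence of a sequence of series in the sense that, for every `K`, the truncations with
at most `K` Lie brackets converge. -/
def TruncTendsto {k X : Type*} [CommRing k] [TopologicalSpace k]
    (x : ℕ → NCSeries k X) (l : NCSeries k X) : Prop :=
  ∀ K : ℕ, Tendsto (fun t => trunc K (x t)) atTop (𝓝 (trunc K l))

/-- A sequence of averages, `μ m` being the average `μ_{m+2}` of `m + 2` elements: it starts with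
`μ_2`, and for every `n = m + 3 > 2` the term `μ_n` is a totally symmetric element of the
completed free Lie algebra on `n` generators which is the common limit of the `n` sequences
`(x_i^t)_t` built from `μ_{n-1}`. -/
structure IsAverageSequence {k : Type*} [Field k] [TopologicalSpace k]
    (μ : (m : ℕ) → NCSeries k (Fin (m + 2))) : Prop where
  start : μ 0 = mu2 k
  isLie : ∀ m, IsLie (μ (m + 1))
  symm : ∀ m, IsTotallySymmetric (μ (m + 1))
  tendsto : ∀ m, ∀ i : Fin (m + 3), TruncTendsto (fun t => avgSeq (μ m) t i) (μ (m + 1))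

end

/-!
The substitution `Φ : x_i ↦ μ (x_1, …, x̂_i, …, x_n)` is an endomorphism of the algebra of series,
and the sequence `(x_i^t)_t` is the orbit of the letter `x_i` under it (`avgSeq_eq`). On linear
parts `Φ` fixes the mean `s` of the letters and multiplies the deviations `x_i - s` by
`q = -1 / (n - 1)`. A Lie polynomial homogeneous of degree at least two is a combination of
iterated brackets of `s` and of the deviations; a bracket containing only `s` vanishes, so up to
terms of higher degree such a polynomial is a sum of eigenvectors of `Φ` for the eigenvalues `q ^ j`
with `j ≥ 1` (`dynkin_homPart_mem_contracted`). Downward induction on the degree then shows that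
`∑ t, Φ ^ t f` converges coefficientwise for every Lie series `f` of order at least two
(`mem_orbitSummable`). As only perturbed scalar recursions `u (t + 1) = r * u t + b t` with `|r| < 1`
are solved on the way, no completeness of the field is needed. It follows that `Φ ^ t s` converges,
as `Φ s - s` has order two, and that `Φ ^ t (x_i - s)` tends to zero (`exists_tendsto_orbit`). The
common limit is a Lie series, is symmetric if `μ` is, and has linear part `s`, so the construction
can be repeated (`exists_next_average`). Uniqueness is that of limits.

Lie series are recognized by the Dynkin–Specht–Wever criterion: `f` without constant term is a Lie
series if and only if the Dynkin operator, which replaces each word by a right-normed bracket,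
multiplies the part of degree `d` by `d` (`IsLie.mem_primitive`, `isLie_of_dynkin_eq`). This is a
closed condition on the coefficients. To start the construction, `μ_2` must be a Lie series, which
is a form of the Baker–Campbell–Hausdorff theorem. It is proved with a notion of group-like series
`g` formulated through the adjoint action and the Dynkin operator, `D g * g = E g` with `E` the Euler
derivation. This notion is visibly multiplicative, and holds for exponentials of multiples of
letters. If `g` is group-like, the identities for the powers `g ^ m = exp (m • log g)` are polynomial
in `m`, hence hold for all scalars in place of `m`, and their terms of degree one say that `log g`
satisfies the criterion (`IsGroupLike.exp_smul_log`, `IsGroupLike.dynkin_log`). The symmetry of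
`μ_2` is the identity `exp x * √g = exp y * √(g⁻¹)` for `g = exp (-x) * exp y`
(`bch_half_bch_comm`).
-/

noncomputable section

namespace NCSeries

/-! ### Order of a series -/

section Order

variable {R X : Type*} [CommRing R]

theorem sub_apply (f g : NCSeries R X) (w : List X) : (f - g) w = f w - g w := rfl

theorem neg_apply (f : NCSeries R X) (w : List X) : (-f) w = -f w := rfl

theorem sum_apply {ι : Type*} (s : Finset ι) (f : ι → NCSeries R X) (w : List X) :
    (∑ i ∈ s, f i) w = ∑ i ∈ s, f i w :=
  Finset.sum_apply w s f

theorem one_nil : (1 : NCSeries R X) [] = 1 := rfl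

/-- The series `f` has order at least `d`: it has no term of degree less than `d`. -/
def OrdGE (d : ℕ) (f : NCSeries R X) : Prop := ∀ w : List X, w.length < d → f w = 0

theorem OrdGE.mono {d e : ℕ} (h : d ≤ e) {f : NCSeries R X} (hf : OrdGE e f) : OrdGE d f :=
  fun w hw => hf w (hw.trans_le h)

theorem ordGE_zero (f : NCSeries R X) : OrdGE 0 f := fun _ hw => absurd hw (by omega)

theorem ordGE_one_iff {f : NCSeries R X} : OrdGE 1 f ↔ f [] = 0 :=
  ⟨fun h => h [] (by simp), fun h w hw => by
    rw [List.length_eq_zero_iff.1 (Nat.lt_one_iff.1 hw), h]⟩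

theorem OrdGE.zero (d : ℕ) : OrdGE d (0 : NCSeries R X) := fun _ _ => rfl

theorem OrdGE.add {d : ℕ} {f g : NCSeries R X} (hf : OrdGE d f) (hg : OrdGE d g) :
    OrdGE d (f + g) := fun w hw => by rw [add_apply, hf w hw, hg w hw, add_zero]

theorem OrdGE.sub {d : ℕ} {f g : NCSeries R X} (hf : OrdGE d f) (hg : OrdGE d g) :
    OrdGE d (f - g) := fun w hw => by rw [sub_apply, hf w hw, hg w hw, sub_zero]

theorem OrdGE.neg {d : ℕ} {f : NCSeries R X} (hf : OrdGE d f) : OrdGE d (-f) := fun w hw => by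
  rw [neg_apply, hf w hw, neg_zero]

theorem OrdGE.smul {d : ℕ} {f : NCSeries R X} (hf : OrdGE d f) (c : R) : OrdGE d (c • f) :=
  fun w hw => by rw [smul_apply, hf w hw, mul_zero]

theorem OrdGE.sum {ι : Type*} {d : ℕ} {s : Finset ι} {f : ι → NCSeries R X}
    (hf : ∀ i ∈ s, OrdGE d (f i)) : OrdGE d (∑ i ∈ s, f i) := fun w hw => by
  rw [sum_apply]; exact Finset.sum_eq_zero fun i hi => hf i hi w hw

theorem OrdGE.mul {d e : ℕ} {f g : NCSeries R X} (hf : OrdGE d f) (hg : OrdGE e g) :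
    OrdGE (d + e) (f * g) := fun w hw => by
  rw [mul_apply]
  refine Finset.sum_eq_zero fun i hi => ?_
  have hi' := Finset.mem_range.1 hi
  by_cases h : i < d
  · rw [hf _ (by rw [List.length_take]; omega), zero_mul]
  · rw [hg _ (by rw [List.length_drop]; omega), mul_zero]

theorem OrdGE.lie {d e : ℕ} {f g : NCSeries R X} (hf : OrdGE d f) (hg : OrdGE e g) :
    OrdGE (d + e) ⁅f, g⁆ := by
  rw [lie_def]
  exact (hf.mul hg).sub (add_comm e d ▸ hg.mul hf)

theorem OrdGE.pow {f : NCSeries R X} (hf : f [] = 0) (m : ℕ) : OrdGE m (f ^ m) := by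
  induction m with
  | zero => exact ordGE_zero _
  | succ m ih => rw [pow_succ]; exact ih.mul (ordGE_one_iff.2 hf)

theorem OrdGE.leftQuot {d : ℕ} {f : NCSeries R X} (hf : OrdGE (d + 1) f) (a : X) :
    OrdGE d (leftQuot a f) := fun w hw => hf (a :: w) (by simpa using hw)

theorem mul_congr {M : ℕ} {f f' g g' : NCSeries R X} (hf : OrdGE M (f - f'))
    (hg : OrdGE M (g - g')) : OrdGE M (f * g - f' * g') := by
  have : f * g - f' * g' = (f - f') * g + f' * (g - g') := by noncomm_ring
  rw [this]
  exact (hf.mul (ordGE_zero g)).add (((ordGE_zero f').mul hg).mono (by omega))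

theorem eq_of_forall_ordGE {f g : NCSeries R X} (h : ∀ M, OrdGE M (f - g)) : f = g := by
  ext w
  exact sub_eq_zero.1 (h (w.length + 1) w (by omega))

theorem lie_apply_nil (f g : NCSeries R X) : (⁅f, g⁆ : NCSeries R X) [] = 0 := by
  rw [lie_def, sub_apply, mul_nil, mul_nil, mul_comm, sub_self]

theorem leftQuot_add (a : X) (f g : NCSeries R X) :
    leftQuot a (f + g) = leftQuot a f + leftQuot a g := rfl

theorem leftQuot_smul (a : X) (c : R) (f : NCSeries R X) :
    leftQuot a (c • f) = c • leftQuot a f := rfl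

theorem leftQuot_mul (a : X) (f g : NCSeries R X) :
    leftQuot a (f * g) = f [] • leftQuot a g + leftQuot a f * g := by
  ext u
  exact mul_cons f g a u

theorem leftQuot_one (a : X) : leftQuot a (1 : NCSeries R X) = 0 := by
  ext u
  simp [leftQuot, one_apply, zero_apply]

theorem letter_nil (x : X) : (letter x : NCSeries R X) [] = 0 := by simp [letter]

theorem letter_singleton [DecidableEq X] (x y : X) :
    (letter x : NCSeries R X) [y] = if y = x then 1 else 0 := by simp [letter]

theorem leftQuot_letter [DecidableEq X] (a x : X) :
    leftQuot a (letter x : NCSeries R X) = if a = x then 1 else 0 := by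
  ext u
  by_cases h : a = x <;> by_cases h' : u = [] <;>
    simp [leftQuot, letter, h, h', one_apply, zero_apply]

theorem letter_mul_cons [DecidableEq X] (x a : X) (f : NCSeries R X) (w : List X) :
    (letter x * f : NCSeries R X) (a :: w) = if a = x then f w else 0 := by
  rw [mul_cons, letter_nil, zero_mul, zero_add, leftQuot_letter]
  split_ifs
  · rw [one_mul]
  · rw [zero_mul, zero_apply]

theorem mul_letter_concat [DecidableEq X] (x a : X) (f : NCSeries R X) (w : List X) :
    (f * letter x : NCSeries R X) (w ++ [a]) = if a = x then f w else 0 := by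
  induction w generalizing f with
  | nil => simp [mul_cons, letter_singleton, mul_nil, letter_nil]
  | cons b w ih =>
    rw [List.cons_append, mul_cons, ih]
    simp [letter, leftQuot]

/-- Over a finite alphabet a series is the sum of its constant term and of its left quotients,
each multiplied by the corresponding letter. -/
theorem eq_sum_letter_mul [Fintype X] (f : NCSeries R X) :
    f = f [] • (1 : NCSeries R X) + ∑ x, letter x * leftQuot x f := by
  classical
  ext w
  cases w with
  | nil => simp [add_apply, smul_apply, sum_apply, one_nil, mul_nil, letter_nil]
  | cons a u =>
    simp [add_apply, smul_apply, sum_apply, one_apply, letter_mul_cons]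
    rfl

end Order

/-! ### The action by iterated brackets and the Dynkin operator -/

section Bracket

variable {R X : Type*} [CommRing R]

/-- Coefficients of the solution `G` of
`G f = B f + ∑ x, ⁅x, G (leftQuot x f)⁆`, the sum being over the letters `x`; the commutator with
a letter removes the first or the last letter of a word, which gives a recursion over words. -/
def bracketRecAux (B : NCSeries R X →ₗ[R] NCSeries R X) (f : NCSeries R X) : List X → R
  | [] => B f []
  | a :: u => B f (a :: u) + bracketRecAux B (leftQuot a f) u
      - bracketRecAux B (leftQuot ((a :: u).getLast (List.cons_ne_nil a u)) f) (a :: u).dropLast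
termination_by w => w.length
decreasing_by all_goals simp

theorem bracketRecAux_linear (B : NCSeries R X →ₗ[R] NCSeries R X) (c : R) (f g : NCSeries R X)
    (w : List X) :
    bracketRecAux B (c • f + g) w = c * bracketRecAux B f w + bracketRecAux B g w := by
  induction h : w.length using Nat.strong_induction_on generalizing w f g with
  | _ n ih =>
    cases w with
    | nil => simp [bracketRecAux, add_apply, smul_apply]
    | cons a u =>
      rw [bracketRecAux, bracketRecAux, bracketRecAux, leftQuot_add, leftQuot_smul, leftQuot_add,
        leftQuot_smul, ih u.length (by simp [← h]) _ _ u rfl,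
        ih (a :: u).dropLast.length (by simp [← h]) _ _ _ rfl, map_add, map_smul, add_apply,
        smul_apply]
      ring

/-- The linear operator `G` with `G f = B f + ∑ x, ⁅x, G (leftQuot x f)⁆`. -/
def bracketRec (B : NCSeries R X →ₗ[R] NCSeries R X) : NCSeries R X →ₗ[R] NCSeries R X where
  toFun f := bracketRecAux B f
  map_add' f g := by
    ext w
    have := bracketRecAux_linear B 1 f g w
    rwa [one_smul, one_mul] at this
  map_smul' c f := by
    ext w
    have h0 : bracketRecAux B 0 w = 0 := by
      have := bracketRecAux_linear B 1 0 0 w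
      rw [one_smul, one_mul, add_zero] at this
      exact left_eq_add.1 this
    have := bracketRecAux_linear B c f 0 w
    rwa [add_zero, h0, add_zero] at this

theorem bracketRec_nil (B : NCSeries R X →ₗ[R] NCSeries R X) (f : NCSeries R X) :
    bracketRec B f [] = B f [] := bracketRecAux.eq_1 B f

theorem bracketRec_cons (B : NCSeries R X →ₗ[R] NCSeries R X) (f : NCSeries R X) (a : X)
    (u : List X) :
    bracketRec B f (a :: u) = B f (a :: u) + bracketRec B (leftQuot a f) u
      - bracketRec B (leftQuot ((a :: u).getLast (List.cons_ne_nil a u)) f) (a :: u).dropLast :=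
  bracketRecAux.eq_2 B f a u

theorem OrdGE.bracketRec {B : NCSeries R X →ₗ[R] NCSeries R X}
    (hB : ∀ d f, OrdGE d f → OrdGE d (B f)) {d : ℕ} {f : NCSeries R X} (hf : OrdGE d f) :
    OrdGE d (bracketRec B f) := by
  intro w hw
  induction h : w.length using Nat.strong_induction_on generalizing w f d with
  | _ n ih =>
    cases w with
    | nil => rw [bracketRec_nil]; exact hB d f hf _ hw
    | cons a u =>
      obtain ⟨e, rfl⟩ : ∃ e, d = e + 1 := ⟨d - 1, by simp at hw; omega⟩
      simp only [List.length_cons] at h hw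
      rw [bracketRec_cons, hB _ f hf _ (by simpa using hw),
        ih u.length (by omega) (hf.leftQuot a) u (by omega) rfl,
        ih (a :: u).dropLast.length (by simp; omega) (hf.leftQuot _) _ (by simp; omega) rfl]
      simp

/-- The inhomogeneous term `f ↦ f [] • v` of the recursion defining `adAct`. -/
def constTermSMul (v : NCSeries R X) : NCSeries R X →ₗ[R] NCSeries R X where
  toFun f := f [] • v
  map_add' f g := by rw [add_apply, add_smul]
  map_smul' c f := by rw [smul_apply, mul_smul]; rfl

/-- The homogeneous part of degree `d` of a series. -/
def homPart (d : ℕ) : NCSeries R X →ₗ[R] NCSeries R X where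
  toFun f := fun w => if w.length = d then f w else 0
  map_add' f g := NCSeries.ext fun w => by
    change (if _ then f w + g w else 0) = (if _ then f w else 0) + (if _ then g w else 0)
    split_ifs <;> simp
  map_smul' c f := NCSeries.ext fun w => by
    change (if _ then c * f w else 0) = c * (if _ then f w else 0)
    split_ifs <;> simp

/-- The adjoint action of the algebra of series on itself: `x₁ ⋯ x_d` acts on `v` as
`⁅x₁, ⁅x₂, … ⁅x_d, v⁆ … ⁆⁆`. -/
def adAct (f v : NCSeries R X) : NCSeries R X := bracketRec (constTermSMul v) f

/-- The Dynkin operator, sending a non-empty word `x₁ ⋯ x_d` to the right-normed bracket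
`⁅x₁, ⁅x₂, … ⁅x_{d-1}, x_d⁆ … ⁆⁆`. -/
def dynkin : NCSeries R X →ₗ[R] NCSeries R X := bracketRec (homPart 1)

theorem adAct_nil (f v : NCSeries R X) : adAct f v [] = f [] * v [] := bracketRec_nil _ _

theorem adAct_cons (f v : NCSeries R X) (a : X) (u : List X) :
    adAct f v (a :: u) = f [] * v (a :: u) + adAct (leftQuot a f) v u
      - adAct (leftQuot ((a :: u).getLast (List.cons_ne_nil a u)) f) v (a :: u).dropLast :=
  bracketRec_cons _ _ _ _

theorem dynkin_nil (f : NCSeries R X) : dynkin f [] = 0 := bracketRec_nil _ _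

theorem dynkin_cons (f : NCSeries R X) (a : X) (u : List X) :
    dynkin f (a :: u) = homPart 1 f (a :: u) + dynkin (leftQuot a f) u
      - dynkin (leftQuot ((a :: u).getLast (List.cons_ne_nil a u)) f) (a :: u).dropLast :=
  bracketRec_cons _ _ _ _

theorem homPart_apply (d : ℕ) (f : NCSeries R X) (w : List X) :
    homPart d f w = if w.length = d then f w else 0 := rfl

theorem adAct_add (f g v : NCSeries R X) : adAct (f + g) v = adAct f v + adAct g v :=
  map_add _ _ _

theorem adAct_sub (f g v : NCSeries R X) : adAct (f - g) v = adAct f v - adAct g v :=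
  map_sub _ _ _

theorem adAct_smul (c : R) (f v : NCSeries R X) : adAct (c • f) v = c • adAct f v :=
  map_smul _ _ _

theorem OrdGE.constTermSMul {v : NCSeries R X} {d : ℕ} {f : NCSeries R X} (hf : OrdGE d f) :
    OrdGE d (constTermSMul v f) := by
  intro w hw
  change f [] * v w = 0
  rw [hf [] (by simp; omega), zero_mul]

theorem OrdGE.homPart {d : ℕ} {f : NCSeries R X} (hf : OrdGE d f) (e : ℕ) :
    OrdGE d (homPart e f) := by
  intro w hw
  rw [homPart_apply, hf w hw, ite_self]

theorem OrdGE.adAct {d : ℕ} {f : NCSeries R X} (hf : OrdGE d f) (v : NCSeries R X) :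
    OrdGE d (adAct f v) := OrdGE.bracketRec (fun _ _ => OrdGE.constTermSMul) hf

theorem OrdGE.dynkin {d : ℕ} {f : NCSeries R X} (hf : OrdGE d f) : OrdGE d (dynkin f) :=
  OrdGE.bracketRec (fun _ _ h => OrdGE.homPart h 1) hf

theorem adAct_one (v : NCSeries R X) : adAct 1 v = v := by
  ext w
  have h0 (w : List X) : adAct 0 v w = 0 := by
    rw [show adAct 0 v = 0 from map_zero _]; rfl
  cases w with
  | nil => rw [adAct_nil, one_nil, one_mul]
  | cons a u => rw [adAct_cons, leftQuot_one, leftQuot_one, h0, h0, one_nil]; ring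

theorem adAct_zero (v : NCSeries R X) : adAct 0 v = 0 := map_zero _

theorem dynkin_one : dynkin (1 : NCSeries R X) = 0 := by
  ext w
  cases w with
  | nil => rw [dynkin_nil, zero_apply]
  | cons a u =>
    rw [dynkin_cons, leftQuot_one, leftQuot_one, map_zero, homPart_apply]
    simp [one_apply, zero_apply]

theorem adAct_mul (f g v : NCSeries R X) : adAct (f * g) v = adAct f (adAct g v) := by
  ext w
  induction h : w.length using Nat.strong_induction_on generalizing w f with
  | _ n ih =>
    cases w with
    | nil => rw [adAct_nil, adAct_nil, adAct_nil, mul_nil, mul_assoc]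
    | cons a u =>
      rw [adAct_cons, adAct_cons f, adAct_cons g, leftQuot_mul, leftQuot_mul, adAct_add, adAct_add,
        adAct_smul, adAct_smul, add_apply, add_apply, smul_apply, smul_apply,
        ih u.length (by simp [← h]) _ u rfl,
        ih (a :: u).dropLast.length (by simp [← h]) _ _ rfl, mul_nil]
      ring

theorem dynkin_mul (f g : NCSeries R X) :
    dynkin (f * g) = adAct f (dynkin g) + g [] • dynkin f := by
  ext w
  induction h : w.length using Nat.strong_induction_on generalizing w f with
  | _ n ih =>
    cases w with
    | nil => simp [dynkin_nil, add_apply, smul_apply, adAct_nil]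
    | cons a u =>
      have hlin : homPart 1 (f * g) (a :: u) = f [] * homPart 1 g (a :: u)
          + g [] * homPart 1 f (a :: u) := by
        simp only [homPart_apply]
        split_ifs with hu
        · rw [List.length_cons, Nat.add_eq_right, List.length_eq_zero_iff] at hu
          rw [hu, mul_cons, mul_nil, leftQuot]; ring
        · ring
      rw [dynkin_cons, add_apply, smul_apply, adAct_cons, dynkin_cons g, dynkin_cons f,
        leftQuot_mul, leftQuot_mul, map_add, map_add,
        map_smul, map_smul, add_apply, add_apply, smul_apply, smul_apply,
        ih u.length (by simp [← h]) _ u rfl,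
        ih (a :: u).dropLast.length (by simp [← h]) _ _ rfl, hlin, add_apply, add_apply,
        smul_apply, smul_apply]
      ring

theorem adAct_letter (x : X) (v : NCSeries R X) :
    adAct (letter x) v = ⁅(letter x : NCSeries R X), v⁆ := by
  classical
  ext w
  have key (a : X) (u : List X) :
      adAct (leftQuot a (letter x : NCSeries R X)) v u = if a = x then v u else 0 := by
    rw [leftQuot_letter]
    split_ifs
    · rw [adAct_one]
    · rw [adAct_zero, zero_apply]
  cases w with
  | nil => rw [lie_apply_nil, adAct_nil, letter_nil, zero_mul]
  | cons a u =>
    rw [adAct_cons, key, key, letter_nil, lie_def, sub_apply, letter_mul_cons]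
    conv_rhs => rw [← List.dropLast_append_getLast (List.cons_ne_nil a u)]
    rw [mul_letter_concat, zero_mul, zero_add]

theorem dynkin_letter (x : X) : dynkin (letter x : NCSeries R X) = letter x := by
  classical
  ext w
  have key (a : X) : dynkin (leftQuot a (letter x : NCSeries R X)) = 0 := by
    rw [leftQuot_letter]
    split_ifs
    · exact dynkin_one
    · exact map_zero _
  cases w with
  | nil => rw [dynkin_nil, letter_nil]
  | cons a u =>
    rw [dynkin_cons, key, key, zero_apply, zero_apply, homPart_apply, add_zero, sub_zero,
      ite_eq_left_iff]
    intro h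
    symm
    simp only [letter, List.cons.injEq]
    rw [if_neg]
    rintro ⟨-, rfl⟩
    simp at h

/-- The Euler derivation, multiplying the part of degree `d` by `d`. -/
def euler : NCSeries R X →ₗ[R] NCSeries R X where
  toFun f := fun w => w.length * f w
  map_add' f g := NCSeries.ext fun w => mul_add _ (f w) (g w)
  map_smul' c f := NCSeries.ext fun w => mul_left_comm _ c (f w)

theorem euler_apply (f : NCSeries R X) (w : List X) : euler f w = w.length * f w := rfl

theorem euler_mul (f g : NCSeries R X) : euler (f * g) = euler f * g + f * euler g := by
  ext w
  simp only [euler_apply, mul_apply, add_apply, Finset.mul_sum, ← Finset.sum_add_distrib]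
  refine Finset.sum_congr rfl fun i hi => ?_
  have hi' := Finset.mem_range.1 hi
  have : (w.length : R) = (w.take i).length + (w.drop i).length := by
    rw [← Nat.cast_add, ← List.length_append, List.take_append_drop]
  rw [this]
  ring

theorem euler_letter (x : X) : euler (letter x : NCSeries R X) = letter x := by
  classical
  ext w
  simp only [euler_apply, letter]
  split_ifs with h
  · simp [h]
  · simp

end Bracket

/-! ### Primitive series and Lie series -/

section Primitive

variable {R X : Type*} [CommRing R]

/-- The primitive series: those without constant term whose adjoint action is the bracket, and on
which the Dynkin operator is the Euler derivation. They form a Lie algebra containing the letters.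
-/
def primitive (R X : Type*) [CommRing R] : LieSubalgebra R (NCSeries R X) where
  carrier := {f | f [] = 0 ∧ (∀ v, adAct f v = ⁅f, v⁆) ∧ dynkin f = euler f}
  add_mem' := by
    rintro f g ⟨hf, hf', hf''⟩ ⟨hg, hg', hg''⟩
    refine ⟨by rw [add_apply, hf, hg, add_zero], fun v => ?_, by rw [map_add, map_add, hf'', hg'']⟩
    rw [adAct_add, hf', hg', add_lie]
  zero_mem' := ⟨rfl, fun v => by rw [adAct_zero, zero_lie], by rw [map_zero, map_zero]⟩
  smul_mem' := by
    rintro c f ⟨hf, hf', hf''⟩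
    refine ⟨by rw [smul_apply, hf, mul_zero], fun v => ?_, by rw [map_smul, map_smul, hf'']⟩
    rw [adAct_smul, hf', smul_lie]
  lie_mem' := by
    rintro f g ⟨hf, hf', hf''⟩ ⟨hg, hg', hg''⟩
    refine ⟨lie_apply_nil f g, fun v => ?_, ?_⟩
    · rw [lie_def, adAct_sub, adAct_mul, adAct_mul, hf', hf', hg', hg', ← lie_def, lie_lie]
    · rw [lie_def, map_sub, map_sub, dynkin_mul, dynkin_mul, hf', hg', hf, hg, hf'', hg'',
        euler_mul, euler_mul, lie_def, lie_def, zero_smul, zero_smul]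
      abel

theorem letter_mem_primitive (x : X) : letter x ∈ primitive R X :=
  ⟨letter_nil x, adAct_letter x, by rw [dynkin_letter, euler_letter]⟩

theorem ofFreeLie_of (x : X) : ofFreeLie R X (FreeLieAlgebra.of R x) = letter x :=
  FreeLieAlgebra.lift_of_apply _ x

theorem letter_mem_range (x : X) : letter x ∈ (ofFreeLie R X).range :=
  ⟨FreeLieAlgebra.of R x, ofFreeLie_of x⟩

/-- A homomorphism from a free Lie algebra takes its values in any Lie subalgebra that contains
the images of the generators. -/
theorem freeLie_lift_mem {L : Type*} [LieRing L] [LieAlgebra R L] (S : LieSubalgebra R L)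
    {a : X → L} (ha : ∀ x, a x ∈ S) (p : FreeLieAlgebra R X) : FreeLieAlgebra.lift R a p ∈ S := by
  have : FreeLieAlgebra.lift R a
      = S.incl.comp (FreeLieAlgebra.lift R fun x => (⟨a x, ha x⟩ : S)) := by
    apply FreeLieAlgebra.hom_ext
    intro x
    rw [LieHom.comp_apply, FreeLieAlgebra.lift_of_apply, FreeLieAlgebra.lift_of_apply]
    rfl
  rw [this, LieHom.comp_apply]
  exact Subtype.property _

theorem range_le_primitive : (ofFreeLie R X).range ≤ primitive R X := by
  rintro _ ⟨p, rfl⟩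
  exact freeLie_lift_mem _ letter_mem_primitive p

theorem OrdGE.euler {d : ℕ} {f : NCSeries R X} (hf : OrdGE d f) : OrdGE d (euler f) :=
  fun w hw => by rw [euler_apply, hf w hw, mul_zero]

theorem mem_primitive_of_forall_ordGE {f : NCSeries R X}
    (h : ∀ M, ∃ g ∈ primitive R X, OrdGE M (f - g)) : f ∈ primitive R X := by
  refine ⟨?_, fun v => eq_of_forall_ordGE fun M => ?_, eq_of_forall_ordGE fun M => ?_⟩
  · obtain ⟨g, hg, hfg⟩ := h 1
    have := hfg [] (by simp)
    rwa [sub_apply, hg.1, sub_zero] at this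
  · obtain ⟨g, hg, hfg⟩ := h M
    have e : adAct f v - ⁅f, v⁆ = adAct (f - g) v - ⁅f - g, v⁆ := by
      rw [adAct_sub, sub_lie, hg.2.1]; abel
    rw [e]
    exact (hfg.adAct v).sub ((hfg.lie (ordGE_zero v)).mono (by omega))
  · obtain ⟨g, hg, hfg⟩ := h M
    have e : dynkin f - NCSeries.euler f = dynkin (f - g) - NCSeries.euler (f - g) := by
      rw [map_sub, map_sub, hg.2.2]; abel
    rw [e]
    exact hfg.dynkin.sub hfg.euler

theorem ordGE_sub_trunc (K : ℕ) (f : NCSeries R X) : OrdGE (K + 2) (f - trunc K f) := by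
  intro w hw
  rw [sub_apply, trunc, if_pos (by omega), sub_self]

theorem IsLie.mem_primitive {f : NCSeries R X} (hf : IsLie f) : f ∈ primitive R X :=
  mem_primitive_of_forall_ordGE fun M =>
    ⟨trunc M f, range_le_primitive (hf M), (ordGE_sub_trunc M f).mono (by omega)⟩

theorem IsLie.apply_nil {f : NCSeries R X} (hf : IsLie f) : f [] = 0 := hf.mem_primitive.1

theorem leftQuot_homPart_succ (d : ℕ) (a : X) (f : NCSeries R X) :
    leftQuot a (homPart (d + 1) f) = homPart d (leftQuot a f) := by
  ext u
  simp [leftQuot, homPart_apply]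

theorem homPart_zero (f : NCSeries R X) : homPart 0 f = f [] • 1 := by
  ext w
  rw [homPart_apply, smul_apply, one_apply]
  split_ifs with h
  · rw [List.length_eq_zero_iff.1 h, mul_one]
  · rw [mul_zero]

theorem dynkin_homPart (d : ℕ) (f : NCSeries R X) :
    dynkin (homPart d f) = homPart d (dynkin f) := by
  induction d generalizing f with
  | zero => rw [homPart_zero, homPart_zero, map_smul, dynkin_one, dynkin_nil, smul_zero, zero_smul]
  | succ d ih =>
    ext w
    cases w with
    | nil => simp [homPart_apply, dynkin_nil]
    | cons a u =>
      rw [dynkin_cons, leftQuot_homPart_succ, leftQuot_homPart_succ, ih, ih, homPart_apply (d + 1),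
        dynkin_cons]
      simp only [homPart_apply, List.length_cons, List.length_dropLast, Nat.add_right_cancel_iff,
        Nat.add_sub_cancel]
      split_ifs <;> simp

theorem dynkin_homPart_succ [Fintype X] (d : ℕ) (f : NCSeries R X) :
    dynkin (homPart (d + 1) f) = ∑ x, (⁅(letter x : NCSeries R X), dynkin (homPart d (leftQuot x f))⁆
      + homPart d (leftQuot x f) [] • letter x) := by
  rw [eq_sum_letter_mul (homPart (d + 1) f), map_add, map_smul, dynkin_one, smul_zero, zero_add,
    map_sum]
  refine Finset.sum_congr rfl fun x _ => ?_
  rw [dynkin_mul, adAct_letter, dynkin_letter, leftQuot_homPart_succ]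

/-- On homogeneous series over a finite alphabet, the Dynkin operator is a finite combination of
iterated brackets of letters. -/
theorem dynkin_homPart_mem_range [Fintype X] (d : ℕ) (f : NCSeries R X) :
    dynkin (homPart d f) ∈ (ofFreeLie R X).range := by
  induction d generalizing f with
  | zero => rw [homPart_zero, map_smul, dynkin_one, smul_zero]; exact zero_mem _
  | succ d ih =>
    rw [dynkin_homPart_succ]
    exact sum_mem fun x _ => add_mem (LieSubalgebra.lie_mem _ (letter_mem_range x) (ih _))
      (SMulMemClass.smul_mem _ (letter_mem_range x))

theorem trunc_eq_sum (K : ℕ) (f : NCSeries R X) :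
    trunc K f = ∑ d ∈ Finset.range (K + 2), homPart d f := by
  ext w
  simp only [trunc, sum_apply, homPart_apply, Finset.sum_ite_eq, Finset.mem_range]
  congr 1
  simp only [eq_iff_iff]
  omega

variable {k : Type*} [Field k] [CharZero k]

theorem homPart_eq_smul_dynkin {f : NCSeries k X} (hf : dynkin f = euler f) {d : ℕ}
    (hd : d ≠ 0) : homPart d f = (d : k)⁻¹ • dynkin (homPart d f) := by
  rw [dynkin_homPart, hf]
  ext w
  have : (d : k) ≠ 0 := by exact_mod_cast hd
  rw [smul_apply, homPart_apply, homPart_apply, euler_apply]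
  split_ifs with h
  · rw [h, inv_mul_cancel_left₀ this]
  · rw [mul_zero]

theorem homPart_mem_range [Fintype X] {f : NCSeries k X} (h0 : f [] = 0)
    (hf : dynkin f = euler f) (d : ℕ) : homPart d f ∈ (ofFreeLie k X).range := by
  rcases eq_or_ne d 0 with rfl | hd
  · rw [homPart_zero, h0, zero_smul]; exact zero_mem _
  · rw [homPart_eq_smul_dynkin hf hd]
    exact SMulMemClass.smul_mem _ (dynkin_homPart_mem_range d f)

/-- The Dynkin–Specht–Wever criterion. -/
theorem isLie_of_dynkin_eq [Fintype X] {f : NCSeries k X} (h0 : f [] = 0)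
    (hf : dynkin f = euler f) : IsLie f := fun K => by
  rw [trunc_eq_sum]
  exact sum_mem fun d _ => homPart_mem_range h0 hf d

end Primitive

/-! ### Substitution -/

section Subst

variable {R X Y : Type*} [CommRing R]

theorem OrdGE.list_prod {a : X → NCSeries R Y} (ha : ∀ x, a x [] = 0) (w : List X) :
    OrdGE w.length (w.map a).prod := by
  induction w with
  | nil => exact ordGE_zero _
  | cons x w ih =>
    rw [List.map_cons, List.prod_cons, List.length_cons, add_comm]
    exact (ordGE_one_iff.2 (ha x)).mul ih

variable [Fintype X]

theorem subst_apply (a : X → NCSeries R Y) (g : NCSeries R X) (v : List Y) :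
    subst a g v = ∑ j ∈ Finset.range (v.length + 1), ∑ w : Fin j → X,
      g (List.ofFn w) * ((List.ofFn w).map a).prod v := rfl

theorem ordGE_subst_sub_sum {a : X → NCSeries R Y} (ha : ∀ x, a x [] = 0) (g : NCSeries R X)
    (M : ℕ) : OrdGE M (subst a g - ∑ j ∈ Finset.range M, ∑ w : Fin j → X,
      g (List.ofFn w) • ((List.ofFn w).map a).prod) := by
  intro v hv
  rw [sub_apply, subst_apply, sum_apply, sub_eq_zero]
  simp only [sum_apply, smul_apply]
  refine Finset.sum_subset (Finset.range_subset_range.2 hv) fun j _ hj => ?_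
  refine Finset.sum_eq_zero fun w _ => ?_
  rw [OrdGE.list_prod ha (List.ofFn w) v, mul_zero]
  rw [Finset.mem_range, not_lt] at hj
  rw [List.length_ofFn]
  omega

theorem subst_nil (a : X → NCSeries R Y) (g : NCSeries R X) : subst a g [] = g [] := by
  simp [subst_apply, one_nil]

/-- Substitution peels off the first letter of each word. -/
theorem subst_eq_sum {a : X → NCSeries R Y} (ha : ∀ x, a x [] = 0) (g : NCSeries R X) :
    subst a g = g [] • (1 : NCSeries R Y) + ∑ x, a x * subst a (leftQuot x g) := by
  ext v
  have key (x : X) : (a x * subst a (leftQuot x g)) v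
      = (a x * ∑ j ∈ Finset.range v.length, ∑ w : Fin j → X,
        leftQuot x g (List.ofFn w) • ((List.ofFn w).map a).prod) v := by
    have := (ordGE_one_iff.2 (ha x)).mul (ordGE_subst_sub_sum ha (leftQuot x g) v.length) v
      (by omega)
    rwa [mul_sub, sub_apply, sub_eq_zero] at this
  rw [add_apply, sum_apply, smul_apply, Finset.sum_congr rfl fun x _ => key x, subst_apply,
    Finset.sum_range_succ', add_comm]
  congr 1
  · simp
  · simp only [Finset.mul_sum, sum_apply]
    rw [Finset.sum_comm]
    refine Finset.sum_congr rfl fun j _ => ?_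
    rw [← (Fin.consEquiv fun _ : Fin (j + 1) => X).sum_comp, Fintype.sum_prod_type]
    refine Finset.sum_congr rfl fun x _ => Finset.sum_congr rfl fun w _ => ?_
    simp [Fin.consEquiv, List.ofFn_succ, leftQuot, smul_apply]

/-- Substitution as a linear map. -/
def substₗ (a : X → NCSeries R Y) : NCSeries R X →ₗ[R] NCSeries R Y where
  toFun := subst a
  map_add' f g := by
    ext v
    simp only [subst_apply, add_apply, add_mul, Finset.sum_add_distrib]
  map_smul' c f := by
    ext v
    simp only [subst_apply, smul_apply, RingHom.id_apply, mul_assoc, Finset.mul_sum]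

theorem subst_add (a : X → NCSeries R Y) (f g : NCSeries R X) :
    subst a (f + g) = subst a f + subst a g := map_add (substₗ a) f g

theorem subst_sub (a : X → NCSeries R Y) (f g : NCSeries R X) :
    subst a (f - g) = subst a f - subst a g := map_sub (substₗ a) f g

theorem subst_smul (a : X → NCSeries R Y) (c : R) (f : NCSeries R X) :
    subst a (c • f) = c • subst a f := map_smul (substₗ a) c f

theorem subst_zero (a : X → NCSeries R Y) : subst a (0 : NCSeries R X) = 0 := map_zero (substₗ a)

theorem subst_sum {ι : Type*} (a : X → NCSeries R Y) (s : Finset ι) (f : ι → NCSeries R X) :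
    subst a (∑ i ∈ s, f i) = ∑ i ∈ s, subst a (f i) := map_sum (substₗ a) f s

theorem OrdGE.subst {a : X → NCSeries R Y} (ha : ∀ x, a x [] = 0) {d : ℕ} {f : NCSeries R X}
    (hf : OrdGE d f) : OrdGE d (subst a f) := by
  induction d generalizing f with
  | zero => exact ordGE_zero _
  | succ d ih =>
    rw [subst_eq_sum ha, hf [] (by simp), zero_smul, zero_add]
    exact OrdGE.sum fun x _ =>
      add_comm d 1 ▸ (ordGE_one_iff.2 (ha x)).mul (ih (hf.leftQuot x))

theorem subst_one {a : X → NCSeries R Y} (ha : ∀ x, a x [] = 0) :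
    subst a (1 : NCSeries R X) = 1 := by
  rw [subst_eq_sum ha, one_nil, one_smul]
  simp only [leftQuot_one, subst_zero, mul_zero, Finset.sum_const_zero, add_zero]

theorem subst_letter {a : X → NCSeries R Y} (ha : ∀ x, a x [] = 0) (x : X) :
    subst a (letter x) = a x := by
  classical
  rw [subst_eq_sum ha, letter_nil, zero_smul, zero_add, Finset.sum_eq_single x]
  · rw [leftQuot_letter, if_pos rfl, subst_one ha, mul_one]
  · intro y _ hy
    rw [leftQuot_letter, if_neg hy, subst_zero, mul_zero]
  · simp

/-- Uniqueness for recursions of the form of `subst_eq_sum`: two families of series whose difference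
at an index `i` is the sum of its values at the indices `s x i`, multiplied by series `b x` without
constant term, are equal. -/
theorem eq_of_leftQuot_rec {Z ι : Type*} [Fintype Z] {b : Z → NCSeries R Y}
    (hb : ∀ x, b x [] = 0) (F G : ι → NCSeries R Y) (s : Z → ι → ι)
    (h : ∀ i, F i - G i = ∑ x, b x * (F (s x i) - G (s x i))) (i : ι) : F i = G i := by
  refine eq_of_forall_ordGE fun M => ?_
  induction M generalizing i with
  | zero => exact ordGE_zero _
  | succ M ih =>
    rw [h]
    exact OrdGE.sum fun x _ => add_comm M 1 ▸ (ordGE_one_iff.2 (hb x)).mul (ih _)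

theorem subst_mul {a : X → NCSeries R Y} (ha : ∀ x, a x [] = 0) (f g : NCSeries R X) :
    subst a (f * g) = subst a f * subst a g := by
  refine eq_of_leftQuot_rec ha (fun f => subst a (f * g)) (fun f => subst a f * subst a g)
    leftQuot (fun f => ?_) f
  rw [subst_eq_sum ha (f * g), subst_eq_sum ha f, mul_nil]
  simp only [leftQuot_mul, subst_add, subst_smul, mul_add, mul_sub, Finset.sum_add_distrib,
    add_mul, Finset.sum_mul, Finset.sum_sub_distrib, mul_assoc, smul_mul_assoc, one_mul]
  conv_lhs => enter [2, 1]; rw [subst_eq_sum ha g]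
  simp only [smul_add, Finset.smul_sum, mul_smul_comm, mul_smul]
  abel

/-- Substitution as an algebra homomorphism. -/
def substHom (a : X → NCSeries R Y) (ha : ∀ x, a x [] = 0) : NCSeries R X →ₐ[R] NCSeries R Y :=
  AlgHom.ofLinearMap (substₗ a) (subst_one ha) (subst_mul ha)

theorem subst_subst {Z : Type*} [Fintype Z] {a : X → NCSeries R Y} (ha : ∀ x, a x [] = 0)
    {b : Z → NCSeries R X} (hb : ∀ x, b x [] = 0) (f : NCSeries R Z) :
    subst a (subst b f) = subst (fun z => subst a (b z)) f := by
  have hab : ∀ z, subst a (b z) [] = 0 := fun z => by rw [subst_nil, hb]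
  refine eq_of_leftQuot_rec hab (fun f => subst a (subst b f)) (subst fun z => subst a (b z))
    leftQuot (fun f => ?_) f
  rw [subst_eq_sum hb, subst_eq_sum hab f, subst_add, subst_smul, subst_one ha, subst_sum]
  simp only [subst_mul ha, mul_sub, Finset.sum_sub_distrib]
  abel

/-- Up to any given order, a Lie series is a Lie polynomial, and the substitution of primitive
series into a Lie polynomial is a value of a homomorphism of Lie algebras. -/
theorem subst_mem_primitive {a : X → NCSeries R Y} (ha : ∀ x, a x ∈ primitive R Y)
    {f : NCSeries R X} (hf : IsLie f) : subst a f ∈ primitive R Y := by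
  have ha0 : ∀ x, a x [] = 0 := fun x => (ha x).1
  refine mem_primitive_of_forall_ordGE fun M => ⟨subst a (trunc M f), ?_, ?_⟩
  · obtain ⟨p, hp⟩ := hf M
    have e : (substHom a ha0 : NCSeries R X →ₗ⁅R⁆ NCSeries R Y).comp (ofFreeLie R X)
        = FreeLieAlgebra.lift R a := by
      apply FreeLieAlgebra.hom_ext
      intro x
      rw [LieHom.comp_apply, FreeLieAlgebra.lift_of_apply, ofFreeLie_of]
      exact subst_letter ha0 x
    have e' := LieHom.congr_fun e p
    rw [LieHom.comp_apply] at e'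
    rw [show subst a (trunc M f) = _ from (congrArg (subst a) hp).symm.trans e']
    exact freeLie_lift_mem _ ha p
  · rw [← subst_sub]
    exact ((ordGE_sub_trunc M f).mono (by omega)).subst ha0

theorem subst_singleton {a : X → NCSeries R Y} (ha : ∀ x, a x [] = 0) (f : NCSeries R X)
    (y : Y) : subst a f [y] = ∑ x, f [x] * a x [y] := by
  rw [subst_eq_sum ha, add_apply, sum_apply, smul_apply]
  simp only [mul_cons, ha, mul_nil, subst_nil, one_apply]
  simp [leftQuot, mul_comm]

end Subst

/-! ### Exponential and logarithm -/

section Exp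

open Finset.HasAntidiagonal (antidiagonal)

variable {k X : Type*} [Field k]

theorem ordGE_powSum_sub_sum (c : ℕ → k) {f : NCSeries k X} (hf : f [] = 0) (M : ℕ) :
    OrdGE M (powSum c f - ∑ m ∈ Finset.range M, c m • f ^ m) := by
  intro w hw
  rw [sub_apply, powSum, sum_apply, sub_eq_zero]
  simp only [smul_apply]
  refine Finset.sum_subset (Finset.range_subset_range.2 hw) fun j _ hj => ?_
  rw [Finset.mem_range, not_lt] at hj
  rw [OrdGE.pow hf j w (by omega), mul_zero]

theorem powSum_nil (c : ℕ → k) (f : NCSeries k X) : powSum c f [] = c 0 := by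
  simp [powSum, one_nil]

theorem powSum_singleton (c : ℕ → k) (f : NCSeries k X) (x : X) :
    powSum c f [x] = c 1 * f [x] := by
  simp [powSum, Finset.sum_range_succ, one_apply]

theorem subst_powSum {Y : Type*} [Fintype X] {a : X → NCSeries k Y} (ha : ∀ x, a x [] = 0)
    (c : ℕ → k) {f : NCSeries k X} (hf : f [] = 0) :
    subst a (powSum c f) = powSum c (subst a f) := by
  refine eq_of_forall_ordGE fun M => ?_
  have h1 := (ordGE_powSum_sub_sum c hf M).subst ha
  have h2 := ordGE_powSum_sub_sum c (f := subst a f) (by rw [subst_nil, hf]) M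
  rw [subst_sub, subst_sum] at h1
  have e : ∀ m, subst a (c m • f ^ m) = c m • subst a f ^ m := fun m => by
    rw [subst_smul]
    exact congrArg (c m • ·) (map_pow (substHom a ha) f m)
  simp only [e] at h1
  simpa using h1.sub h2

theorem exp_nil (f : NCSeries k X) : exp f [] = 1 := by simp [exp, powSum_nil]

theorem log_nil (f : NCSeries k X) : log f [] = 0 := by simp [log, powSum_nil]

theorem exp_singleton (f : NCSeries k X) (x : X) : exp f [x] = f [x] := by
  simp [exp, powSum_singleton]

theorem log_singleton (f : NCSeries k X) (x : X) : log f [x] = f [x] := by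
  simp [log, powSum_singleton, sub_apply, one_apply]

theorem subst_exp {Y : Type*} [Fintype X] {a : X → NCSeries k Y} (ha : ∀ x, a x [] = 0)
    {f : NCSeries k X} (hf : f [] = 0) : subst a (exp f) = exp (subst a f) :=
  subst_powSum ha _ hf

theorem subst_log {Y : Type*} [Fintype X] {a : X → NCSeries k Y} (ha : ∀ x, a x [] = 0)
    {f : NCSeries k X} (hf : f [] = 1) : subst a (log f) = log (subst a f) := by
  rw [log, subst_powSum ha _ (by rw [sub_apply, hf, one_nil, sub_self]), subst_sub, subst_one ha]
  rfl

/-- Rearrangement of a double sum of terms that vanish above the diagonal. -/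
theorem sum_range_sum_range_eq {A : Type*} [AddCommMonoid A] (M : ℕ) (t : ℕ → ℕ → A)
    (ht : ∀ m l, M ≤ m + l → t m l = 0) :
    ∑ m ∈ Finset.range M, ∑ l ∈ Finset.range M, t m l
      = ∑ n ∈ Finset.range M, ∑ p ∈ antidiagonal n, t p.1 p.2 := by
  rw [← Finset.sum_product', Finset.sum_sigma']
  symm
  refine Finset.sum_of_injOn (fun p => p.2) ?_ ?_ ?_ ?_
  · rintro ⟨n, p⟩ hp ⟨n', p'⟩ hp' h
    simp only [Finset.coe_sigma, Set.mem_sigma_iff, Finset.mem_coe,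
      Finset.HasAntidiagonal.mem_antidiagonal] at hp hp' h
    subst h
    obtain rfl : n = n' := by rw [← hp.2, ← hp'.2]
    rfl
  · rintro ⟨n, p⟩ hp
    simp only [Finset.coe_sigma, Set.mem_sigma_iff, Finset.mem_coe,
      Finset.HasAntidiagonal.mem_antidiagonal, Finset.mem_range, Finset.coe_product, Set.mem_prod] at hp ⊢
    omega
  · rintro ⟨m, l⟩ _ h
    refine ht m l ?_
    by_contra hlt
    exact h ⟨⟨m + l, (m, l)⟩, by simpa using hlt, rfl⟩
  · intro _ _; rfl

theorem ordGE_exp_sub_sum {f : NCSeries k X} (hf : f [] = 0) (M : ℕ) :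
    OrdGE M (exp f - ∑ m ∈ Finset.range M, (1 / (m.factorial : k)) • f ^ m) :=
  ordGE_powSum_sub_sum _ hf M

theorem exp_zero : exp (0 : NCSeries k X) = 1 := by
  refine eq_of_forall_ordGE fun M => ?_
  cases M with
  | zero => exact ordGE_zero _
  | succ M =>
    have := ordGE_exp_sub_sum (f := (0 : NCSeries k X)) rfl (M + 1)
    simpa [Finset.sum_range_succ'] using this

variable [CharZero k]

theorem sum_factorial_smul_eq {V : Type*} [AddCommGroup V] [Module k V] (n : ℕ) (u : ℕ → ℕ → V) :
    ∑ p ∈ antidiagonal n,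
        ((1 / (p.1.factorial : k)) * (1 / (p.2.factorial : k))) • u p.1 p.2
      = (1 / (n.factorial : k)) • ∑ p ∈ antidiagonal n, n.choose p.1 • u p.1 p.2 := by
  rw [Finset.smul_sum]
  refine Finset.sum_congr rfl fun p hp => ?_
  obtain rfl := Finset.HasAntidiagonal.mem_antidiagonal.1 hp
  rw [← Nat.cast_smul_eq_nsmul k, smul_smul]
  congr 1
  have h := Nat.add_choose_mul_factorial_mul_factorial p.1 p.2
  rw [← Nat.choose_symm_add] at h
  have h1 : ((p.1 + p.2).factorial : k) ≠ 0 := by exact_mod_cast Nat.factorial_ne_zero _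
  have h2 : (p.1.factorial : k) ≠ 0 := by exact_mod_cast Nat.factorial_ne_zero _
  have h3 : (p.2.factorial : k) ≠ 0 := by exact_mod_cast Nat.factorial_ne_zero _
  have h' : ((p.1 + p.2).choose p.1 : k) * p.1.factorial * p.2.factorial
    = (p.1 + p.2).factorial := by exact_mod_cast h
  field_simp
  rw [← h']; ring

/-- Expansion of `⟨exp f, exp g⟩` for a bilinear pairing, presented by the values `u m l` on
`(f ^ m, g ^ l)`: modulo order `M`, the double sum collapses along antidiagonals. -/
theorem sum_exp_sum_exp (M : ℕ) (u : ℕ → ℕ → NCSeries k X)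
    (hu : ∀ m l, OrdGE (m + l) (u m l)) :
    OrdGE M (∑ m ∈ Finset.range M, ∑ l ∈ Finset.range M,
        ((1 / (m.factorial : k)) * (1 / (l.factorial : k))) • u m l
      - ∑ n ∈ Finset.range M, (1 / (n.factorial : k)) •
        ∑ p ∈ antidiagonal n, n.choose p.1 • u p.1 p.2) := by
  intro w hw
  simp only [← sum_factorial_smul_eq]
  rw [sub_apply, sub_eq_zero]
  simp only [sum_apply, smul_apply]
  exact sum_range_sum_range_eq M
    (fun m l => ((1 / (m.factorial : k)) * (1 / (l.factorial : k))) * u m l w)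
    fun m l hml => by rw [hu m l w (by omega), mul_zero]

theorem exp_add {f g : NCSeries k X} (hf : f [] = 0) (hg : g [] = 0) (h : Commute f g) :
    exp (f + g) = exp f * exp g := by
  refine eq_of_forall_ordGE fun M => ?_
  have h1 := ordGE_exp_sub_sum (f := f + g) (by rw [add_apply, hf, hg, add_zero]) M
  have h2 := mul_congr (ordGE_exp_sub_sum hf M) (ordGE_exp_sub_sum hg M)
  have h3 := sum_exp_sum_exp M (fun m l => f ^ m * g ^ l)
    fun m l => (OrdGE.pow hf m).mul (OrdGE.pow hg l)
  simp only [← h.add_pow'] at h3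
  simp only [Finset.sum_mul_sum, smul_mul_smul_comm] at h2
  have := (h1.sub h2).sub h3
  convert this using 1
  abel

theorem exp_add_smul (a b : k) {f : NCSeries k X} (hf : f [] = 0) :
    exp ((a + b) • f) = exp (a • f) * exp (b • f) := by
  rw [add_smul]
  exact exp_add (by rw [smul_apply, hf, mul_zero]) (by rw [smul_apply, hf, mul_zero])
    (((Commute.refl f).smul_left a).smul_right b)

theorem exp_neg_mul_exp {f : NCSeries k X} (hf : f [] = 0) : exp (-f) * exp f = 1 := by
  have := exp_add_smul (-1 : k) 1 hf
  rwa [neg_add_cancel, zero_smul, exp_zero, neg_smul, one_smul, eq_comm] at this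

theorem exp_natCast_smul (n : ℕ) {f : NCSeries k X} (hf : f [] = 0) :
    exp ((n : k) • f) = exp f ^ n := by
  induction n with
  | zero => rw [Nat.cast_zero, zero_smul, exp_zero, pow_zero]
  | succ n ih => rw [Nat.cast_succ, exp_add_smul _ _ hf, ih, one_smul, pow_succ]

/-- For `f` acting by the bracket, conjugation by `exp f` is the action of `exp f`. -/
theorem adAct_exp_mul_exp {f : NCSeries k X} (hf : f [] = 0) (had : ∀ v, adAct f v = ⁅f, v⁆)
    (v : NCSeries k X) : adAct (exp f) v * exp f = exp f * v := by
  have hpow (m : ℕ) (v : NCSeries k X) : adAct (f ^ m) v = (LieAlgebra.ad k _ f ^ m) v := by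
    induction m generalizing v with
    | zero => rw [pow_zero, pow_zero, adAct_one, Module.End.one_apply]
    | succ m ih =>
      rw [pow_succ', pow_succ', adAct_mul, had, ih, Module.End.mul_apply, LieAlgebra.ad_apply]
  -- left multiplication by `f` is the sum of `ad f` and of right multiplication by `f`
  have hbin (n : ℕ) : f ^ n * v
      = ∑ p ∈ antidiagonal n, n.choose p.1 • (adAct (f ^ p.1) v * f ^ p.2) := by
    have hc : Commute (LieAlgebra.ad k _ f) (LinearMap.mulRight k f) := by
      refine LinearMap.ext fun u => ?_
      simp only [Module.End.mul_apply, LieAlgebra.ad_apply, LinearMap.mulRight_apply, lie_def]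
      rw [sub_mul, mul_assoc, mul_assoc]
    have hl : LieAlgebra.ad k _ f + LinearMap.mulRight k f = LinearMap.mulLeft k f := by
      ext u
      simp [LieAlgebra.ad_apply, lie_def]
    have := LinearMap.congr_fun (hc.add_pow' n) v
    rw [hl, LinearMap.pow_mulLeft, LinearMap.mulLeft_apply] at this
    rw [this, LinearMap.sum_apply]
    refine Finset.sum_congr rfl fun p _ => ?_
    rw [LinearMap.smul_apply, ((hc.pow_left p.1).pow_right p.2).eq, Module.End.mul_apply,
      LinearMap.pow_mulRight, LinearMap.mulRight_apply, hpow]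
  refine eq_of_forall_ordGE fun M => ?_
  have h1 := mul_congr (ordGE_exp_sub_sum hf M) (show OrdGE M (v - v) by
    rw [sub_self]; exact OrdGE.zero M)
  have h2 := ((ordGE_exp_sub_sum hf M).adAct v)
  rw [adAct_sub] at h2
  have h2' := mul_congr h2 (ordGE_exp_sub_sum hf M)
  have h3 := sum_exp_sum_exp M (fun m l => adAct (f ^ m) v * f ^ l)
    fun m l => ((OrdGE.pow hf m).adAct v).mul (OrdGE.pow hf l)
  simp only [← hbin] at h3
  have e : adAct (∑ m ∈ Finset.range M, (1 / (m.factorial : k)) • f ^ m) v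
      = ∑ m ∈ Finset.range M, (1 / (m.factorial : k)) • adAct (f ^ m) v := by
    change bracketRec (constTermSMul v) _ = _
    rw [map_sum]
    simp only [map_smul]
    rfl
  rw [e] at h2'
  simp only [Finset.sum_mul_sum, smul_mul_smul_comm] at h2'
  simp only [Finset.sum_mul, smul_mul_assoc] at h1
  have := (h2'.sub h1).add h3
  convert this using 1
  abel

/-- The identity `exp (log (1 + x)) = 1 + x` in one variable: applying the Euler derivation, both
sides solve the same first order differential equation. -/
theorem exp_log_one_add_letter :
    exp (log (1 + letter () : NCSeries k Unit)) = 1 + letter () := by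
  classical
  set x : NCSeries k Unit := letter () with hx
  -- a word in one letter is determined by its length
  have hcomm (f g : NCSeries k Unit) : f * g = g * f := by
    ext w
    rw [mul_apply, mul_apply, ← Finset.sum_range_reflect]
    refine Finset.sum_congr rfl fun i hi => ?_
    have hi' := Finset.mem_range.1 hi
    have hword (u v : List Unit) (h : u.length = v.length) : u = v :=
      List.ext_getElem h fun _ _ _ => rfl
    rw [mul_comm, hword (w.drop (w.length + 1 - 1 - i)) (w.take i) (by simp; omega),
      hword (w.take (w.length + 1 - 1 - i)) (w.drop i) (by simp)]
  have hpow (m : ℕ) (w : List Unit) : (x ^ m) w = if w.length = m then 1 else 0 := by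
    induction m generalizing w with
    | zero => rw [pow_zero, one_apply]
    | succ m ih =>
      rw [pow_succ']
      cases w with
      | nil => rw [mul_nil, hx, letter_nil]; simp
      | cons a u => rw [hx, letter_mul_cons, if_pos rfl, ← hx, ih]; simp
  set z := log (1 + x) with hz
  have hz0 : z [] = 0 := log_nil _
  have hzw (w : List Unit) (hw : w.length ≠ 0) :
      z w = (-1) ^ (w.length + 1) / (w.length : k) := by
    rw [hz, log, add_sub_cancel_left, powSum, Finset.sum_eq_single w.length]
    · rw [hpow, if_pos rfl, if_neg hw, mul_one]
    · intro m _ hm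
      rw [hpow, if_neg hm.symm, mul_zero]
    · simp
  have hEz : (1 + x) * euler z = x := by
    ext w
    rw [add_mul, one_mul, add_apply, euler_apply]
    cases w with
    | nil => rw [mul_nil, hx, letter_nil]; simp
    | cons a u =>
      have hne : ((a :: u).length : k) ≠ 0 := by exact_mod_cast (by simp)
      rw [hzw _ (by simp), mul_div_cancel₀ _ hne, hx, letter_mul_cons, if_pos rfl, euler_apply]
      cases u with
      | nil => simp [letter]
      | cons b u =>
        have hne : ((b :: u).length : k) ≠ 0 := by exact_mod_cast (by simp)
        rw [hzw _ (by simp), mul_div_cancel₀ _ hne]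
        simp [letter, pow_succ]
  have hEpow (m : ℕ) : euler (z ^ (m + 1)) = ((m + 1 : ℕ) : k) • (euler z * z ^ m) := by
    induction m with
    | zero => simp
    | succ m ih =>
      rw [pow_succ, euler_mul, ih, Nat.cast_succ (m + 1), add_smul, one_smul, hcomm _ (euler z),
        smul_mul_assoc, mul_assoc, ← pow_succ]
  have hE : euler (exp z) = euler z * exp z := by
    refine eq_of_forall_ordGE fun M => ?_
    have h1 := (ordGE_exp_sub_sum hz0 (M + 1)).euler
    have h2 := mul_congr (show OrdGE M (euler z - euler z) by rw [sub_self]; exact OrdGE.zero M)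
      (ordGE_exp_sub_sum hz0 M)
    have e : euler (∑ m ∈ Finset.range (M + 1), (1 / (m.factorial : k)) • z ^ m)
        = euler z * ∑ m ∈ Finset.range M, (1 / (m.factorial : k)) • z ^ m := by
      rw [map_sum, Finset.sum_range_succ', Finset.mul_sum]
      have h0 : euler ((1 / ((0 : ℕ).factorial : k)) • z ^ 0) = 0 := by
        ext w
        simp only [pow_zero, smul_apply, euler_apply, one_apply, zero_apply]
        split_ifs with h <;> simp [h]
      rw [h0, add_zero]
      refine Finset.sum_congr rfl fun m _ => ?_
      rw [map_smul, hEpow, smul_smul, mul_smul_comm]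
      congr 1
      have h1 : ((m + 1 : ℕ) : k) ≠ 0 := by exact_mod_cast Nat.succ_ne_zero m
      have h2 : (m.factorial : k) ≠ 0 := by exact_mod_cast Nat.factorial_ne_zero _
      rw [Nat.factorial_succ, Nat.cast_mul]
      field_simp
    rw [map_sub, e] at h1
    have := (h1.mono (Nat.le_succ M)).sub h2
    convert this using 1
    abel
  -- `exp z` solves `(1 + x) y' = y` (in the form `(1 + x) E y = x y`), whose solutions are
  -- determined by their constant term
  have hode : (1 + x) * euler (exp z) = x * exp z := by rw [hE, ← mul_assoc, hEz]
  have hrec (a : Unit) (u : List Unit) :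
      ((u.length : k) + 1) * exp z (a :: u) = (1 - u.length) * exp z u := by
    have h := congrFun hode (a :: u)
    change ((1 + x) * euler (exp z) : NCSeries k Unit) (a :: u)
      = (x * exp z : NCSeries k Unit) (a :: u) at h
    rw [add_mul, one_mul, add_apply, hx, letter_mul_cons, letter_mul_cons, if_pos rfl, if_pos rfl,
      euler_apply, euler_apply, List.length_cons, Nat.cast_succ] at h
    linear_combination h
  have h2 (w : List Unit) (hw : 2 ≤ w.length) : exp z w = 0 := by
    induction w with
    | nil => simp at hw
    | cons a u ih =>
      have hne : (u.length : k) + 1 ≠ 0 := Nat.cast_add_one_ne_zero u.length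
      have h := hrec a u
      have : (1 - (u.length : k)) * exp z u = 0 := by
        rcases (show u.length = 1 ∨ 2 ≤ u.length by simp at hw; omega) with h1 | h1
        · rw [h1]; simp
        · rw [ih h1, mul_zero]
      rw [this] at h
      exact (mul_eq_zero.1 h).resolve_left hne
  ext w
  rcases w with _ | ⟨a, _ | ⟨b, u⟩⟩
  · rw [exp_nil, add_apply, one_nil, hx, letter_nil, add_zero]
  · have := hrec a []
    rw [exp_nil] at this
    simpa [add_apply, one_apply, hx, letter_singleton] using this
  · rw [h2 _ (by simp)]
    simp [add_apply, one_apply, hx, letter]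

theorem exp_log {g : NCSeries k X} (hg : g [] = 1) : exp (log g) = g := by
  have ha : ∀ _ : Unit, (g - 1) [] = 0 := fun _ => by rw [sub_apply, hg, one_nil, sub_self]
  have h := congrArg (subst fun _ : Unit => g - 1) (exp_log_one_add_letter (k := k))
  rw [subst_exp ha (log_nil _), subst_log ha (by simp [add_apply, one_nil, letter_nil]), subst_add,
    subst_one ha, subst_letter ha] at h
  simpa using h

end Exp

/-! ### Group-like series -/

section GroupLike

variable {k X : Type*} [Field k]

/-- The group-like series, characterized without coproduct: their adjoint action is conjugation,
and the Dynkin operator acts on them as the right logarithmic derivative of the Euler derivation.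
-/
structure IsGroupLike (g : NCSeries k X) : Prop where
  apply_nil : g [] = 1
  adAct_mul : ∀ v, adAct g v * g = g * v
  dynkin_mul : dynkin g * g = euler g

theorem euler_one : euler (1 : NCSeries k X) = 0 := by
  ext w
  rw [euler_apply, one_apply, zero_apply]
  split_ifs with h <;> simp [h]

theorem IsGroupLike.one : IsGroupLike (1 : NCSeries k X) :=
  ⟨one_nil, fun v => by rw [adAct_one, mul_one, one_mul], by rw [dynkin_one, zero_mul, euler_one]⟩

theorem IsGroupLike.mul {g h : NCSeries k X} (hg : IsGroupLike g) (hh : IsGroupLike h) :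
    IsGroupLike (g * h) where
  apply_nil := by rw [mul_nil, hg.apply_nil, hh.apply_nil, mul_one]
  adAct_mul v := by
    rw [NCSeries.adAct_mul, ← mul_assoc, hg.adAct_mul, mul_assoc, hh.adAct_mul, mul_assoc]
  dynkin_mul := by
    rw [NCSeries.dynkin_mul, hh.apply_nil, one_smul, add_mul, ← mul_assoc, hg.adAct_mul,
      ← mul_assoc, hg.dynkin_mul, mul_assoc, hh.dynkin_mul, euler_mul, add_comm]

theorem IsGroupLike.pow {g : NCSeries k X} (hg : IsGroupLike g) (n : ℕ) :
    IsGroupLike (g ^ n) := by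
  induction n with
  | zero => rw [pow_zero]; exact .one
  | succ n ih => rw [pow_succ]; exact ih.mul hg

/-! ### Polynomial one-parameter families -/

open Polynomial in
/-- The coefficients of `F c` are polynomials in the scalar `c`, and `F₀` and `F₁` are the
coefficients of `c ^ 0` and `c ^ 1` in `F c`. -/
def IsPolyFamily (F : k → NCSeries k X) (F₀ F₁ : NCSeries k X) : Prop :=
  ∀ w, ∃ p : k[X], (∀ c, F c w = p.eval c) ∧ p.coeff 0 = F₀ w ∧ p.coeff 1 = F₁ w

theorem IsPolyFamily.const (v : NCSeries k X) : IsPolyFamily (fun _ => v) v 0 := fun w =>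
  ⟨Polynomial.C (v w), by simp, by simp, by simp [zero_apply]⟩

theorem IsPolyFamily.sub {F G : k → NCSeries k X} {F₀ F₁ G₀ G₁ : NCSeries k X}
    (hF : IsPolyFamily F F₀ F₁) (hG : IsPolyFamily G G₀ G₁) :
    IsPolyFamily (fun c => F c - G c) (F₀ - G₀) (F₁ - G₁) := fun w => by
  obtain ⟨p, hp, hp0, hp1⟩ := hF w
  obtain ⟨q, hq, hq0, hq1⟩ := hG w
  exact ⟨p - q, fun c => by simp [sub_apply, hp, hq], by simp [hp0, hq0, sub_apply],
    by simp [hp1, hq1, sub_apply]⟩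

theorem IsPolyFamily.mul {F G : k → NCSeries k X} {F₀ F₁ G₀ G₁ : NCSeries k X}
    (hF : IsPolyFamily F F₀ F₁) (hG : IsPolyFamily G G₀ G₁) :
    IsPolyFamily (fun c => F c * G c) (F₀ * G₀) (F₀ * G₁ + F₁ * G₀) := fun w => by
  choose p hp hp0 hp1 using hF
  choose q hq hq0 hq1 using hG
  refine ⟨∑ i ∈ Finset.range (w.length + 1), p (w.take i) * q (w.drop i), fun c => ?_, ?_, ?_⟩
  · simp only [mul_apply, hp, hq, Polynomial.eval_finsetSum, Polynomial.eval_mul]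
  · simp only [mul_apply, Polynomial.finsetSum_coeff, Polynomial.mul_coeff_zero, hp0, hq0]
  · simp only [mul_apply, add_apply, Polynomial.finsetSum_coeff, Polynomial.mul_coeff_one, hp0,
      hq0, hp1, hq1, Finset.sum_add_distrib]

theorem IsPolyFamily.euler {F : k → NCSeries k X} {F₀ F₁ : NCSeries k X}
    (hF : IsPolyFamily F F₀ F₁) :
    IsPolyFamily (fun c => euler (F c)) (euler F₀) (euler F₁) := fun w => by
  obtain ⟨p, hp, hp0, hp1⟩ := hF w
  exact ⟨Polynomial.C (w.length : k) * p, fun c => by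
      change w.length * F c w = _
      rw [hp, Polynomial.eval_C_mul],
    by rw [euler_apply, Polynomial.coeff_C_mul, hp0],
    by rw [euler_apply, Polynomial.coeff_C_mul, hp1]⟩

theorem IsPolyFamily.leftQuot {F : k → NCSeries k X} {F₀ F₁ : NCSeries k X}
    (hF : IsPolyFamily F F₀ F₁) (a : X) :
    IsPolyFamily (fun c => leftQuot a (F c)) (leftQuot a F₀) (leftQuot a F₁) := fun w => hF (a :: w)

theorem IsPolyFamily.bracketRec {B : NCSeries k X →ₗ[k] NCSeries k X}
    (hB : ∀ w, ∃ w' r, ∀ f, B f w = r * f w') {F : k → NCSeries k X} {F₀ F₁ : NCSeries k X}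
    (hF : IsPolyFamily F F₀ F₁) :
    IsPolyFamily (fun c => bracketRec B (F c)) (bracketRec B F₀) (bracketRec B F₁) := by
  intro w
  beta_reduce
  induction h : w.length using Nat.strong_induction_on generalizing w F F₀ F₁ with
  | _ n ih =>
    obtain ⟨w', r, hr⟩ := hB w
    obtain ⟨p, hp, hp0, hp1⟩ := hF w'
    have hB0 : (Polynomial.C r * p).coeff 0 = B F₀ w := by rw [Polynomial.coeff_C_mul, hp0, hr]
    have hB1 : (Polynomial.C r * p).coeff 1 = B F₁ w := by rw [Polynomial.coeff_C_mul, hp1, hr]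
    have hBc (c : k) : B (F c) w = (Polynomial.C r * p).eval c := by
      rw [Polynomial.eval_C_mul, ← hp, hr]
    cases w with
    | nil =>
      exact ⟨_, fun c => by rw [bracketRec_nil, hBc], by rw [bracketRec_nil, hB0],
        by rw [bracketRec_nil, hB1]⟩
    | cons a u =>
      obtain ⟨q, hq, hq0, hq1⟩ := ih u.length (by simp [← h]) (hF.leftQuot a) u rfl
      obtain ⟨s, hs, hs0, hs1⟩ := ih (a :: u).dropLast.length (by simp [← h])
        (hF.leftQuot ((a :: u).getLast (List.cons_ne_nil a u))) (a :: u).dropLast rfl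
      refine ⟨Polynomial.C r * p + q - s, fun c => ?_, ?_, ?_⟩
      · rw [bracketRec_cons, hBc, hq, hs, Polynomial.eval_sub, Polynomial.eval_add]
      · rw [bracketRec_cons, Polynomial.coeff_sub, Polynomial.coeff_add, hB0, hq0, hs0]
      · rw [bracketRec_cons, Polynomial.coeff_sub, Polynomial.coeff_add, hB1, hq1, hs1]

theorem IsPolyFamily.adAct {F : k → NCSeries k X} {F₀ F₁ : NCSeries k X}
    (hF : IsPolyFamily F F₀ F₁) (v : NCSeries k X) :
    IsPolyFamily (fun c => adAct (F c) v) (adAct F₀ v) (adAct F₁ v) :=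
  IsPolyFamily.bracketRec (fun w => ⟨[], v w, fun f => mul_comm (f []) (v w)⟩) hF

theorem IsPolyFamily.dynkin {F : k → NCSeries k X} {F₀ F₁ : NCSeries k X}
    (hF : IsPolyFamily F F₀ F₁) :
    IsPolyFamily (fun c => dynkin (F c)) (dynkin F₀) (dynkin F₁) :=
  IsPolyFamily.bracketRec
    (fun w => ⟨w, if w.length = 1 then 1 else 0, fun f => by rw [homPart_apply]; simp⟩) hF

theorem isPolyFamily_exp_smul {f : NCSeries k X} (hf : f [] = 0) :
    IsPolyFamily (fun c => exp (c • f)) 1 f := fun w => by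
  refine ⟨∑ m ∈ Finset.range (w.length + 1),
    Polynomial.C (1 / (m.factorial : k) * (f ^ m) w) * Polynomial.X ^ m, fun c => ?_, ?_, ?_⟩
  · change powSum _ (c • f) w = _
    rw [powSum, Polynomial.eval_finsetSum]
    refine Finset.sum_congr rfl fun m _ => ?_
    rw [smul_pow, NCSeries.smul_apply]
    simp only [Polynomial.eval_mul, Polynomial.eval_C, Polynomial.eval_pow, Polynomial.eval_X]
    ring
  · simp [Polynomial.coeff_X_pow]
  · simp only [Polynomial.finsetSum_coeff, Polynomial.coeff_C_mul, Polynomial.coeff_X_pow,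
      mul_ite, mul_one, mul_zero, Finset.sum_ite_eq, Finset.mem_range]
    cases w with
    | nil => simp [hf]
    | cons a u => simp

theorem mul_singleton (f g : NCSeries k X) (x : X) :
    (f * g) [x] = f [] * g [x] + f [x] * g [] := by
  rw [mul_cons, mul_nil]; rfl

theorem bch_singleton (f g : NCSeries k X) (x : X) : bch f g [x] = f [x] + g [x] := by
  rw [bch, log_singleton, mul_singleton, exp_nil, exp_nil, exp_singleton, exp_singleton]
  ring

theorem bch_nil (f g : NCSeries k X) : bch f g [] = 0 := log_nil _

theorem subst_bch {Y : Type*} [Fintype X] {a : X → NCSeries k Y} (ha : ∀ x, a x [] = 0)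
    {f g : NCSeries k X} (hf : f [] = 0) (hg : g [] = 0) :
    subst a (bch f g) = bch (subst a f) (subst a g) := by
  rw [bch, subst_log ha (by rw [mul_nil, exp_nil, exp_nil, mul_one]), subst_mul ha,
    subst_exp ha hf, subst_exp ha hg, bch]

variable [CharZero k]

/-- A polynomial family vanishing at all natural numbers vanishes identically. -/
theorem IsPolyFamily.eq_zero {F : k → NCSeries k X} {F₀ F₁ : NCSeries k X}
    (hF : IsPolyFamily F F₀ F₁) (h : ∀ n : ℕ, F n = 0) : (∀ c, F c = 0) ∧ F₁ = 0 := by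
  have key (w : List X) : (∀ c, F c w = 0) ∧ F₁ w = 0 := by
    obtain ⟨p, hp, -, hp1⟩ := hF w
    have : p = 0 := by
      refine Polynomial.eq_zero_of_infinite_isRoot p
        ((Set.infinite_range_of_injective (Nat.cast_injective (R := k))).mono ?_)
      rintro _ ⟨n, rfl⟩
      rw [Set.mem_ofPred_eq, Polynomial.IsRoot, ← hp, h, zero_apply]
    exact ⟨fun c => by rw [hp, this, Polynomial.eval_zero],
      by rw [← hp1, this, Polynomial.coeff_zero]⟩
  exact ⟨fun c => NCSeries.ext fun w => (key w).1 c, NCSeries.ext fun w => (key w).2⟩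

/-- The one-parameter group through a group-like series consists of group-like series: this holds
for natural powers, and the defining identities are polynomial in the parameter. -/
theorem IsGroupLike.exp_smul_log {g : NCSeries k X} (hg : IsGroupLike g) (c : k) :
    IsGroupLike (exp (c • log g)) := by
  have hn (n : ℕ) : IsGroupLike (exp ((n : k) • log g)) := by
    rw [exp_natCast_smul n (log_nil g), exp_log hg.apply_nil]
    exact hg.pow n
  have hE := isPolyFamily_exp_smul (log_nil g)
  refine ⟨exp_nil _, fun v => ?_, ?_⟩
  · exact sub_eq_zero.1 ((((hE.adAct v).mul hE).sub (hE.mul (.const v))).eq_zero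
      (fun n => sub_eq_zero.2 ((hn n).adAct_mul v)) |>.1 c)
  · exact sub_eq_zero.1 (((hE.dynkin.mul hE).sub hE.euler).eq_zero
      (fun n => sub_eq_zero.2 (hn n).dynkin_mul) |>.1 c)

/-- The logarithm of a group-like series satisfies the Dynkin–Specht–Wever criterion: compare the
terms of degree one in the parameter along its one-parameter group. -/
theorem IsGroupLike.dynkin_log {g : NCSeries k X} (hg : IsGroupLike g) :
    dynkin (log g) = euler (log g) := by
  have hE := isPolyFamily_exp_smul (log_nil g)
  have h := ((hE.dynkin.mul hE).sub hE.euler).eq_zero (fun n => sub_eq_zero.2 <| by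
    rw [exp_natCast_smul n (log_nil g), exp_log hg.apply_nil]
    exact (hg.pow n).dynkin_mul) |>.2
  rwa [dynkin_one, zero_mul, zero_add, mul_one, sub_eq_zero] at h

theorem IsGroupLike.isLie_log [Fintype X] {g : NCSeries k X} (hg : IsGroupLike g) :
    IsLie (log g) := isLie_of_dynkin_eq (log_nil g) hg.dynkin_log

theorem isGroupLike_exp_smul_letter (c : k) (x : X) :
    IsGroupLike (exp (c • letter x : NCSeries k X)) := by
  set f : NCSeries k X := c • letter x with hf
  have hmem : f ∈ primitive k X := SMulMemClass.smul_mem c (letter_mem_primitive x)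
  have hE : euler f = f := by rw [hf, map_smul, euler_letter]
  have hD : dynkin f = f := by rw [hf, map_smul, dynkin_letter]
  have hEpow (m : ℕ) : euler (f ^ m) = (m : k) • f ^ m := by
    induction m with
    | zero => rw [pow_zero, euler_one, Nat.cast_zero, zero_smul]
    | succ m ih => rw [pow_succ, euler_mul, ih, hE, Nat.cast_succ, add_smul, one_smul,
        smul_mul_assoc]
  -- the bracket `⁅f, f⁆` occurs in all these iterated brackets
  have hDpow (m : ℕ) : dynkin (f ^ (m + 2)) = 0 := by
    induction m with
    | zero => rw [zero_add, pow_two, dynkin_mul, hD, hmem.1, hmem.2.1, lie_self, zero_smul,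
        add_zero]
    | succ m ih =>
      rw [show m + 1 + 2 = (m + 2) + 1 from rfl, pow_succ', dynkin_mul, ih, hmem.2.1, lie_zero,
        OrdGE.pow hmem.1 (m + 2) [] (by simp), zero_smul, add_zero]
  have hDexp : dynkin (exp f) = f := by
    refine eq_of_forall_ordGE fun M => ?_
    have h := (ordGE_exp_sub_sum hmem.1 (M + 2)).dynkin
    rw [map_sub, map_sum, Finset.sum_range_succ', Finset.sum_range_succ'] at h
    simp only [map_smul, hDpow, smul_zero, Finset.sum_const_zero] at h
    simp only [zero_add, pow_one, Nat.factorial_one, Nat.cast_one, div_one, one_smul, pow_zero,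
      dynkin_one, smul_zero, add_zero, hD] at h
    exact h.mono (by omega)
  have hEexp : euler (exp f) = f * exp f := by
    refine eq_of_forall_ordGE fun M => ?_
    have h := (ordGE_exp_sub_sum hmem.1 (M + 1)).euler
    have h' := mul_congr (show OrdGE M (f - f) by rw [sub_self]; exact OrdGE.zero M)
      (ordGE_exp_sub_sum hmem.1 M)
    have e : euler (∑ m ∈ Finset.range (M + 1), (1 / (m.factorial : k)) • f ^ m)
        = f * ∑ m ∈ Finset.range M, (1 / (m.factorial : k)) • f ^ m := by
      rw [map_sum, Finset.sum_range_succ', pow_zero, map_smul, euler_one, smul_zero, add_zero,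
        Finset.mul_sum]
      refine Finset.sum_congr rfl fun m _ => ?_
      rw [map_smul, hEpow, smul_smul, mul_smul_comm, pow_succ']
      congr 1
      have h1 : ((m + 1 : ℕ) : k) ≠ 0 := by exact_mod_cast Nat.succ_ne_zero m
      have h2 : (m.factorial : k) ≠ 0 := by exact_mod_cast Nat.factorial_ne_zero _
      rw [Nat.factorial_succ, Nat.cast_mul]
      field_simp
    rw [map_sub, e] at h
    have := (h.mono (Nat.le_succ M)).sub h'
    convert this using 1
    abel
  exact ⟨exp_nil f, adAct_exp_mul_exp hmem.1 hmem.2.1, by rw [hDexp, hEexp]⟩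

/-- A series with constant term `1` has at most one square root with constant term `1`. -/
theorem eq_of_mul_self_eq {g h : NCSeries k X} (hg : g [] = 1) (hh : h [] = 1)
    (e : g * g = h * h) : g = h := by
  refine eq_of_forall_ordGE fun M => ?_
  induction M with
  | zero => exact ordGE_zero _
  | succ M ih =>
    have hg' : OrdGE 1 (g - 1) := ordGE_one_iff.2 (by rw [sub_apply, hg, one_nil, sub_self])
    have hh' : OrdGE 1 (h - 1) := ordGE_one_iff.2 (by rw [sub_apply, hh, one_nil, sub_self])
    have h2 : (2 : k) • (g - h) = -((g - h) * (g - 1) + (h - 1) * (g - h)) := by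
      have : (g - h) * (g - 1) + (h - 1) * (g - h) = g * g - h * h - (2 : k) • (g - h) := by
        rw [two_smul]; noncomm_ring
      rw [this, e]; abel
    have h3 : g - h = (2 : k)⁻¹ • -((g - h) * (g - 1) + (h - 1) * (g - h)) := by
      rw [← h2, smul_smul, inv_mul_cancel₀ two_ne_zero, one_smul]
    rw [h3]
    exact ((ih.mul hg').add (add_comm M 1 ▸ hh'.mul ih)).neg.smul _

/-! ### The average of two elements -/

theorem isLie_mu2 : IsLie (mu2 k) := by
  have h0 := isGroupLike_exp_smul_letter (1 : k) (0 : Fin 2)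
  have h0' := isGroupLike_exp_smul_letter (-1 : k) (0 : Fin 2)
  have h1 := isGroupLike_exp_smul_letter (1 : k) (1 : Fin 2)
  rw [one_smul] at h0 h1
  rw [neg_smul, one_smul] at h0'
  exact (h0.mul ((h0'.mul h1).exp_smul_log (1 / 2))).isLie_log

theorem mu2_singleton (i : Fin 2) : mu2 k [i] = 1 / 2 := by
  rw [mu2, bch_singleton, smul_apply, bch_singleton, neg_apply, letter_singleton, letter_singleton]
  fin_cases i
  · norm_num
  · norm_num

/-- With `g = exp (-x) * exp y`, the two sides are the logarithms of `exp x * √g` and of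
`exp y * √(g⁻¹)`, and `exp y = exp x * g`. -/
theorem bch_half_bch_comm {x y : NCSeries k X} (hx : x [] = 0) (hy : y [] = 0) :
    bch y ((1 / 2 : k) • bch (-y) x) = bch x ((1 / 2 : k) • bch (-x) y) := by
  have hexp (z : NCSeries k X) (hz : z [] = 0) : exp z * exp (-z) = 1 := by
    have := exp_neg_mul_exp (f := -z) (by rw [neg_apply, hz, neg_zero])
    rwa [neg_neg] at this
  have hsq (z : NCSeries k X) (hz : z [] = 0) :
      exp ((1 / 2 : k) • z) * exp ((1 / 2 : k) • z) = exp z := by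
    rw [← exp_add_smul _ _ hz, add_halves, one_smul]
  have hz : bch (-x) y [] = 0 := bch_nil _ _
  have hlog : exp (bch (-x) y) = exp (-x) * exp y :=
    exp_log (by rw [mul_nil, exp_nil, exp_nil, mul_one])
  have hlog' : exp (bch (-y) x) = exp (-y) * exp x :=
    exp_log (by rw [mul_nil, exp_nil, exp_nil, mul_one])
  have hroot : exp ((1 / 2 : k) • bch (-y) x) = exp (-((1 / 2 : k) • bch (-x) y)) := by
    refine eq_of_mul_self_eq (exp_nil _) (exp_nil _) ?_
    rw [hsq _ (bch_nil _ _), ← smul_neg, hsq _ (by rw [neg_apply, hz, neg_zero]), hlog']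
    calc exp (-y) * exp x
        = exp (-y) * exp x * (exp (bch (-x) y) * exp (-bch (-x) y)) := by
          rw [hexp _ hz, mul_one]
      _ = exp (-y) * (exp x * exp (-x)) * exp y * exp (-bch (-x) y) := by
          rw [hlog]; noncomm_ring
      _ = exp (-bch (-x) y) := by
          rw [hexp x hx, mul_one, exp_neg_mul_exp hy, one_mul]
  have hz' : ((1 / 2 : k) • bch (-x) y) [] = 0 := by rw [smul_apply, hz, mul_zero]
  have hy' : exp y = exp x * (exp ((1 / 2 : k) • bch (-x) y) * exp ((1 / 2 : k) • bch (-x) y)) := by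
    rw [hsq _ hz, hlog, ← mul_assoc, hexp x hx, one_mul]
  rw [bch, bch.eq_1 x]
  congr 1
  rw [hroot, hy', mul_assoc, mul_assoc, hexp _ hz', mul_one]

theorem isTotallySymmetric_mu2 : IsTotallySymmetric (mu2 k) := by
  intro σ
  have hl (x : Fin 2) : (letter (σ x) : NCSeries k (Fin 2)) [] = 0 := letter_nil _
  have h0 : (-letter (0 : Fin 2) : NCSeries k (Fin 2)) [] = 0 := by
    rw [neg_apply, letter_nil, neg_zero]
  have e : subst (fun i => letter (σ i)) (mu2 k) = bch (letter (σ 0))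
      ((1 / 2 : k) • bch (-letter (σ 0)) (letter (σ 1))) := by
    rw [mu2, subst_bch hl (letter_nil _) (by rw [smul_apply, bch_nil, mul_zero]), subst_smul,
      subst_bch hl h0 (letter_nil _), ← neg_one_smul k (letter 0), subst_smul, subst_letter hl,
      subst_letter hl, neg_one_smul]
  rw [e]
  rcases (show σ 0 = 0 ∨ σ 0 = 1 by omega) with h | h
  · have h1 : σ 1 = 1 := by
      have : σ 1 ≠ σ 0 := fun h' => by simpa using σ.injective h'
      omega
    rw [h, h1, mu2]
  · have h1 : σ 1 = 0 := by
      have : σ 1 ≠ σ 0 := fun h' => by simpa using σ.injective h'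
      omega
    rw [h, h1, mu2]
    exact bch_half_bch_comm (letter_nil _) (letter_nil _)

end GroupLike

/-! ### Limits of series -/

section Limits

variable {k : Type*} [NormedField k]

/-- A perturbed linear recursion with a contracting factor converges, without completeness. -/
theorem tendsto_of_linear_rec {r : k} (hr : ‖r‖ < 1) {u b : ℕ → k} {β : k}
    (hb : Tendsto b atTop (𝓝 β)) (hu : ∀ t, u (t + 1) = r * u t + b t) :
    Tendsto u atTop (𝓝 (β / (1 - r))) := by
  have hr1 : 1 - r ≠ 0 := fun h => by
    rw [← sub_eq_zero.1 h, norm_one] at hr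
    exact lt_irrefl _ hr
  set L := β / (1 - r) with hL
  have hβ : β = L - r * L := by rw [hL]; field_simp
  have hstep (t : ℕ) : ‖u (t + 1) - L‖ ≤ ‖r‖ * ‖u t - L‖ + ‖b t - β‖ := by
    rw [hu, ← norm_mul, show r * u t + b t - L = r * (u t - L) + (b t - β) by rw [hβ]; ring]
    exact norm_add_le _ _
  rw [Metric.tendsto_atTop] at hb ⊢
  intro ε hε
  obtain ⟨T, hT⟩ := hb (ε / 2 * (1 - ‖r‖)) (by have := sub_pos.2 hr; positivity)
  have hbound (s : ℕ) : ‖u (T + s) - L‖ ≤ ‖r‖ ^ s * ‖u T - L‖ + ε / 2 := by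
    induction s with
    | zero => rw [add_zero, pow_zero, one_mul]; linarith
    | succ s ih =>
      have h1 := hstep (T + s)
      have h2 := hT (T + s) (by omega)
      rw [dist_eq_norm] at h2
      have h3 := mul_le_mul_of_nonneg_left ih (norm_nonneg r)
      rw [← add_assoc, pow_succ]
      nlinarith
  have hlim : Tendsto (fun s => ‖r‖ ^ s * ‖u T - L‖) atTop (𝓝 0) := by
    simpa using (tendsto_pow_atTop_nhds_zero_of_lt_one (norm_nonneg r) hr).mul_const ‖u T - L‖
  obtain ⟨S, hS⟩ := (hlim.eventually (gt_mem_nhds (half_pos hε))).exists_forall_of_atTop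
  refine ⟨T + S, fun t ht => ?_⟩
  have h1 := hbound (t - T)
  have h2 := hS (t - T) (by omega)
  rw [show T + (t - T) = t by omega] at h1
  rw [dist_eq_norm]
  linarith

variable {X : Type*}

theorem truncTendsto_iff {u : ℕ → NCSeries k X} {ν : NCSeries k X} :
    TruncTendsto u ν ↔ ∀ w, Tendsto (fun t => u t w) atTop (𝓝 (ν w)) := by
  constructor
  · intro h w
    have e (f : NCSeries k X) : trunc w.length f w = f w := if_pos (Nat.le_succ _)
    have := ((continuous_apply w).tendsto (trunc w.length ν)).comp (h w.length)
    rw [← e ν]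
    exact this.congr fun t => e (u t)
  · intro h K
    refine tendsto_pi_nhds.2 fun w => ?_
    by_cases hw : w.length ≤ K + 1
    · simpa [trunc, hw] using h w
    · simp [trunc, hw]

theorem tendsto_dynkin {u : ℕ → NCSeries k X} {ν : NCSeries k X}
    (h : ∀ w, Tendsto (fun t => u t w) atTop (𝓝 (ν w))) (w : List X) :
    Tendsto (fun t => dynkin (u t) w) atTop (𝓝 (dynkin ν w)) := by
  induction hn : w.length using Nat.strong_induction_on generalizing w u ν with
  | _ n ih =>
    cases w with
    | nil => simp only [dynkin_nil, tendsto_const_nhds]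
    | cons a u =>
      simp only [dynkin_cons, homPart_apply]
      refine (Tendsto.add ?_ (ih u.length (by simp [← hn]) (fun w => h (a :: w)) u rfl)).sub
        (ih (a :: u).dropLast.length (by simp [← hn]) (fun w => h (_ :: w)) _ rfl)
      split_ifs
      · exact h _
      · exact tendsto_const_nhds

variable [Fintype X]

theorem tendsto_subst {Y : Type*} (a : X → NCSeries k Y) {u : ℕ → NCSeries k X}
    {ν : NCSeries k X} (h : ∀ w, Tendsto (fun t => u t w) atTop (𝓝 (ν w))) (v : List Y) :
    Tendsto (fun t => subst a (u t) v) atTop (𝓝 (subst a ν v)) := by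
  simp only [subst_apply]
  exact tendsto_finsetSum _ fun j _ => tendsto_finsetSum _ fun w _ => (h _).mul_const _

theorem isLie_of_tendsto [CharZero k] {u : ℕ → NCSeries k X} {ν : NCSeries k X}
    (hu : ∀ t, u t ∈ primitive k X) (h : ∀ w, Tendsto (fun t => u t w) atTop (𝓝 (ν w))) :
    IsLie ν := by
  refine isLie_of_dynkin_eq ?_ (NCSeries.ext fun w => ?_)
  · exact tendsto_nhds_unique (h []) (tendsto_const_nhds.congr fun t => (hu t).1.symm)
  · refine tendsto_nhds_unique (tendsto_dynkin h w) ?_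
    rw [euler_apply]
    exact ((h w).const_mul _).congr fun t => by rw [(hu t).2.2, euler_apply]

end Limits

/-! ### Iteration of a substitution -/

section Iteration

variable {k X : Type*} [NormedField k]

/-- The series `f` for which the coefficients of `∑ t, Φ ^ t f` at words of length less than `M`
converge. -/
def orbitSummable (Φ : Module.End k (NCSeries k X)) (M : ℕ) : Submodule k (NCSeries k X) where
  carrier := {f | ∀ w : List X, w.length < M →
    ∃ l, Tendsto (fun T => ∑ t ∈ Finset.range T, (Φ ^ t) f w) atTop (𝓝 l)}
  add_mem' := by
    intro f g hf hg w hw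
    obtain ⟨l, hl⟩ := hf w hw
    obtain ⟨l', hl'⟩ := hg w hw
    refine ⟨l + l', (hl.add hl').congr fun T => ?_⟩
    simp only [map_add, add_apply, Finset.sum_add_distrib]
  zero_mem' := fun w _ => ⟨0, tendsto_const_nhds.congr fun T => by simp [zero_apply]⟩
  smul_mem' := by
    intro c f hf w hw
    obtain ⟨l, hl⟩ := hf w hw
    refine ⟨c * l, (hl.const_mul c).congr fun T => ?_⟩
    simp only [map_smul, smul_apply, Finset.mul_sum]

theorem tendsto_zero_of_mem_orbitSummable {Φ : Module.End k (NCSeries k X)} {M : ℕ}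
    {f : NCSeries k X} (hf : f ∈ orbitSummable Φ M) {w : List X} (hw : w.length < M) :
    Tendsto (fun t => (Φ ^ t) f w) atTop (𝓝 0) := by
  obtain ⟨l, hl⟩ := hf w hw
  have := ((tendsto_add_atTop_iff_nat 1).2 hl).sub hl
  rw [sub_self] at this
  exact this.congr fun T => by rw [Finset.sum_range_succ, add_sub_cancel_left]

/-- The partial sums of the orbit of `f` satisfy a linear recursion of factor `r`, perturbed by
the partial sums of the orbit of `Φ f - r • f`. -/
theorem mem_orbitSummable_of_sub_smul_mem {Φ : Module.End k (NCSeries k X)} {M : ℕ} {r : k}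
    (hr : ‖r‖ < 1) {f : NCSeries k X} (hf : Φ f - r • f ∈ orbitSummable Φ M) :
    f ∈ orbitSummable Φ M := by
  intro w hw
  obtain ⟨l, hl⟩ := hf w hw
  refine ⟨_, tendsto_of_linear_rec hr (hl.const_add (f w)) fun T => ?_⟩
  rw [Finset.sum_range_succ', Finset.mul_sum]
  have e (t : ℕ) : (Φ ^ (t + 1)) f w = r * (Φ ^ t) f w + (Φ ^ t) (Φ f - r • f) w := by
    rw [pow_succ, Module.End.mul_apply, map_sub, map_smul, sub_apply, smul_apply]
    ring
  simp only [e, Finset.sum_add_distrib, pow_zero, Module.End.one_apply]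
  ring

variable [Fintype X]

theorem OrdGE.substₗ_pow {a : X → NCSeries k X} (ha : ∀ x, a x [] = 0) {d : ℕ}
    {f : NCSeries k X} (hf : OrdGE d f) (t : ℕ) : OrdGE d ((substₗ a ^ t) f) := by
  induction t with
  | zero => exact hf
  | succ t ih => rw [pow_succ', Module.End.mul_apply]; exact ih.subst ha

/-- The series `f` is, up to terms of degree greater than `d`, an eigenvector of homogeneous
degree `d` of the substitution of `a`, for the eigenvalue `r`. -/
def IsEigenMod (a : X → NCSeries k X) (d : ℕ) (r : k) (f : NCSeries k X) : Prop :=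
  OrdGE d f ∧ OrdGE (d + 1) (subst a f - r • f)

theorem IsEigenMod.lie {a : X → NCSeries k X} (ha : ∀ x, a x [] = 0) {d e : ℕ} {r r' : k}
    {f g : NCSeries k X} (hf : IsEigenMod a d r f) (hg : IsEigenMod a e r' g) :
    IsEigenMod a (d + e) (r * r') ⁅f, g⁆ := by
  refine ⟨hf.1.lie hg.1, ?_⟩
  have h : subst a ⁅f, g⁆ - (r * r') • ⁅f, g⁆
      = ⁅subst a f - r • f, subst a g⁆ + ⁅r • f, subst a g - r' • g⁆ := by
    rw [lie_def, subst_sub, subst_mul ha, subst_mul ha, ← lie_def, sub_lie, lie_sub, smul_lie,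
      smul_lie, lie_smul, smul_smul, ← lie_def]
    abel
  rw [h]
  exact ((hf.2.lie (hg.1.subst ha)).mono (by omega)).add
    (((hf.1.smul r).lie hg.2).mono (by omega))

/-- The span of the primitive eigenvectors, up to higher degree, for a contracted eigenvalue. -/
def contracted (a : X → NCSeries k X) (d : ℕ) : Submodule k (NCSeries k X) :=
  Submodule.span k {f | f ∈ primitive k X ∧ ∃ r : k, ‖r‖ < 1 ∧ IsEigenMod a d r f}

theorem mem_contracted {a : X → NCSeries k X} {d : ℕ} {f : NCSeries k X}
    (hf : f ∈ primitive k X) {r : k} (hr : ‖r‖ < 1) (h : IsEigenMod a d r f) :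
    f ∈ contracted a d := Submodule.subset_span ⟨hf, r, hr, h⟩

section

variable {a : X → NCSeries k X} (ha : ∀ x, a x ∈ primitive k X) {s : NCSeries k X}
  (hs : s ∈ primitive k X) (hs1 : IsEigenMod a 1 1 s) {q : k} (hq : ‖q‖ < 1)
  (hx : ∀ x, IsEigenMod a 1 q (letter x - s))

include ha hs hs1 hq hx

/-- In degree at least two every iterated bracket of letters is a sum of contracted eigenvectors:
writing each letter as the fixed vector `s` plus a contracted one, the only monomials without a
contracted factor are the brackets of `s` with itself, which vanish. -/
theorem dynkin_homPart_mem_contracted (d : ℕ) (f : NCSeries k X) :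
    dynkin (homPart (d + 2) f) ∈ contracted a (d + 2) := by
  have ha0 : ∀ x, a x [] = 0 := fun x => (ha x).1
  have hy (x : X) : letter x - s ∈ primitive k X := sub_mem (letter_mem_primitive x) hs
  have hletter (x : X) : (letter x : NCSeries k X) = s + (letter x - s) := by abel
  induction d generalizing f with
  | zero =>
    rw [dynkin_homPart_succ]
    refine sum_mem fun x _ => ?_
    rw [homPart_apply, if_neg (by simp), zero_smul, add_zero, dynkin_homPart_succ, lie_sum]
    refine sum_mem fun y _ => ?_
    rw [homPart_zero, map_smul, dynkin_one, smul_zero, lie_zero, zero_add (_ • _),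
      lie_smul]
    refine Submodule.smul_mem _ _ ?_
    rw [hletter x, hletter y, add_lie, lie_add, lie_add, lie_self, zero_add ⁅s, _⁆]
    refine add_mem ?_ (add_mem ?_ ?_)
    · exact mem_contracted (LieSubalgebra.lie_mem _ hs (hy y)) (by rwa [one_mul])
        (hs1.lie ha0 (hx y))
    · exact mem_contracted (LieSubalgebra.lie_mem _ (hy x) hs) (by rwa [mul_one])
        ((hx x).lie ha0 hs1)
    · exact mem_contracted (LieSubalgebra.lie_mem _ (hy x) (hy y))
        (by rw [norm_mul]; exact mul_lt_one_of_nonneg_of_lt_one_left (norm_nonneg q) hq hq.le)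
        ((hx x).lie ha0 (hx y))
  | succ d ih =>
    rw [dynkin_homPart_succ]
    refine sum_mem fun x _ => ?_
    rw [homPart_apply, if_neg (by simp), zero_smul, add_zero]
    have key : ∀ g ∈ contracted a (d + 2), ⁅(letter x : NCSeries k X), g⁆
        ∈ contracted a (d + 1 + 2) := by
      intro g hg
      induction hg using Submodule.span_induction with
      | zero => rw [lie_zero]; exact zero_mem _
      | add g h _ _ hg hh => rw [lie_add]; exact add_mem hg hh
      | smul c g _ hg => rw [lie_smul]; exact Submodule.smul_mem _ c hg
      | mem g hg =>
        obtain ⟨hg, r, hr, hg'⟩ := hg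
        rw [hletter x, add_lie]
        refine add_mem ?_ ?_
        · refine mem_contracted (LieSubalgebra.lie_mem _ hs hg) (r := 1 * r) (by rwa [one_mul]) ?_
          rw [show d + 1 + 2 = 1 + (d + 2) by omega]
          exact hs1.lie ha0 hg'
        · refine mem_contracted (LieSubalgebra.lie_mem _ (hy x) hg) (r := q * r) ?_ ?_
          · rw [norm_mul]
            exact mul_lt_one_of_nonneg_of_lt_one_left (norm_nonneg q) hq hr.le
          · rw [show d + 1 + 2 = 1 + (d + 2) by omega]
            exact (hx x).lie ha0 hg'
    exact key _ (ih _)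

variable [CharZero k]

/-- Downward induction on the order: the leading part of a Lie series is a combination of
contracted eigenvectors, each of which is multiplied by its eigenvalue up to a Lie series of
larger order. -/
theorem mem_orbitSummable (M : ℕ) {d : ℕ} (hd : 2 ≤ d) {f : NCSeries k X}
    (hf : f ∈ primitive k X) (hfd : OrdGE d f) : f ∈ orbitSummable (substₗ a) M := by
  have ha0 : ∀ x, a x [] = 0 := fun x => (ha x).1
  obtain ⟨n, hn⟩ : ∃ n, M ≤ d + n := ⟨M, by omega⟩
  induction n generalizing d f with
  | zero =>
    intro w hw
    refine ⟨0, tendsto_const_nhds.congr fun T => (Finset.sum_eq_zero fun t _ => ?_).symm⟩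
    exact hfd.substₗ_pow ha0 t w (by omega)
  | succ n ih =>
    have hcon : contracted a d ≤ orbitSummable (substₗ a) M := by
      refine Submodule.span_le.2 ?_
      rintro g ⟨hg, r, hr, hgd, hgr⟩
      refine mem_orbitSummable_of_sub_smul_mem hr (ih (d := d + 1) (by omega) ?_ hgr (by omega))
      exact sub_mem (subst_mem_primitive ha (isLie_of_dynkin_eq hg.1 hg.2.2))
        (SMulMemClass.smul_mem r hg)
    have hlead : homPart d f ∈ orbitSummable (substₗ a) M := by
      rw [homPart_eq_smul_dynkin hf.2.2 (by omega)]
      refine Submodule.smul_mem _ _ (hcon ?_)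
      obtain ⟨e, rfl⟩ : ∃ e, d = e + 2 := ⟨d - 2, by omega⟩
      exact dynkin_homPart_mem_contracted ha hs hs1 hq hx e f
    have hrest : f - homPart d f ∈ orbitSummable (substₗ a) M := by
      refine ih (d := d + 1) (by omega)
        (sub_mem hf (range_le_primitive (homPart_mem_range hf.1 hf.2.2 d))) (fun w hw => ?_)
        (by omega)
      rw [sub_apply, homPart_apply]
      split_ifs with h
      · rw [sub_self]
      · rw [hfd w (by omega), sub_zero]
    have := add_mem hrest hlead
    rwa [sub_add_cancel] at this

/-- The orbits of all letters converge to a common limit, with the same linear part as `s`. -/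
theorem exists_tendsto_orbit : ∃ ν : NCSeries k X, OrdGE 2 (ν - s) ∧
    ∀ x w, Tendsto (fun t => (substₗ a ^ t) (letter x) w) atTop (𝓝 (ν w)) := by
  have ha0 : ∀ x, a x [] = 0 := fun x => (ha x).1
  have hmem {r : k} {f : NCSeries k X} (hf : f ∈ primitive k X) (h : IsEigenMod a 1 r f) (M : ℕ) :
      substₗ a f - r • f ∈ orbitSummable (substₗ a) M :=
    mem_orbitSummable ha hs hs1 hq hx M le_rfl
      (sub_mem (subst_mem_primitive ha (isLie_of_dynkin_eq hf.1 hf.2.2))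
        (SMulMemClass.smul_mem r hf)) h.2
  have hsum (T : ℕ) : (substₗ a ^ T) s
      = s + ∑ t ∈ Finset.range T, (substₗ a ^ t) (substₗ a s - (1 : k) • s) := by
    induction T with
    | zero => simp
    | succ T ih =>
      rw [Finset.sum_range_succ, ← add_assoc, ← ih, one_smul, map_sub, pow_succ,
        Module.End.mul_apply]
      abel
  have hS (w : List X) : ∃ l, Tendsto (fun t => (substₗ a ^ t) s w) atTop (𝓝 l) := by
    obtain ⟨l, hl⟩ := hmem hs hs1 (w.length + 1) w (by omega)
    refine ⟨s w + l, (hl.const_add (s w)).congr fun T => ?_⟩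
    rw [hsum, add_apply, sum_apply]
  obtain ⟨ν, hν⟩ : ∃ ν : NCSeries k X, ∀ w,
      Tendsto (fun t => (substₗ a ^ t) s w) atTop (𝓝 (ν w)) :=
    ⟨fun w => (hS w).choose, fun w => (hS w).choose_spec⟩
  refine ⟨ν, fun w hw => ?_, fun x w => ?_⟩
  · have hconst : Tendsto (fun t => (substₗ a ^ t) s w) atTop (𝓝 (s w)) := by
      refine tendsto_const_nhds.congr fun T => ?_
      rw [hsum, add_apply, sum_apply, Finset.sum_eq_zero, add_zero]
      exact fun t _ => OrdGE.substₗ_pow ha0 hs1.2 t w hw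
    rw [sub_apply, sub_eq_zero]
    exact tendsto_nhds_unique (hν w) hconst
  · have hy := mem_orbitSummable_of_sub_smul_mem hq
      (hmem (sub_mem (letter_mem_primitive x) hs) (hx x) (w.length + 1))
    have h := (tendsto_zero_of_mem_orbitSummable hy (Nat.lt_succ_self w.length)).add (hν w)
    rw [zero_add] at h
    exact h.congr fun t => by rw [← add_apply, ← map_add, sub_add_cancel]

end

end Iteration

/-! ### The averaging iteration -/

section Average

variable {k : Type*} [NormedField k] {N : ℕ}

/-- The first step of the iteration built from `μ`. -/
def avgStep (μ : NCSeries k (Fin N)) (i : Fin (N + 1)) : NCSeries k (Fin (N + 1)) :=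
  subst (fun j => letter (i.succAbove j)) μ

theorem substₗ_pow_subst {X Y : Type*} [Fintype X] [Fintype Y] {a : X → NCSeries k X}
    (ha : ∀ x, a x [] = 0) {b : Y → NCSeries k X} (hb : ∀ y, b y [] = 0) (f : NCSeries k Y)
    (t : ℕ) : (substₗ a ^ t) (subst b f) = subst (fun y => (substₗ a ^ t) (b y)) f := by
  induction t with
  | zero => rfl
  | succ t ih =>
    simp only [pow_succ', Module.End.mul_apply]
    rw [ih]
    exact subst_subst ha
      (fun y => (ordGE_one_iff.2 (hb y)).substₗ_pow ha t [] (by simp)) f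

theorem avgSeq_succ (μ : NCSeries k (Fin N)) (t : ℕ) (i : Fin (N + 1)) :
    avgSeq μ (t + 1) i = subst (fun j => avgSeq μ t (i.succAbove j)) μ := rfl

theorem avgStep_nil {μ : NCSeries k (Fin N)} (hμ : μ [] = 0) (i : Fin (N + 1)) :
    avgStep μ i [] = 0 := by rw [avgStep, subst_nil, hμ]

/-- The iteration is the orbit of the letters under the substitution of its first step. -/
theorem avgSeq_eq {μ : NCSeries k (Fin N)} (hμ : μ [] = 0) (t : ℕ) (i : Fin (N + 1)) :
    avgSeq μ t i = (substₗ (avgStep μ) ^ t) (letter i) := by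
  have ha := avgStep_nil hμ
  induction t generalizing i with
  | zero => rfl
  | succ t ih =>
    rw [avgSeq_succ, pow_succ, Module.End.mul_apply]
    simp only [ih]
    rw [← substₗ_pow_subst ha (fun j => letter_nil _)]
    exact congrArg _ (subst_letter ha i).symm

/-- A permutation of the indices permutes the sequences of the iteration: the permutation induced
on the arguments of `μ` is absorbed by the symmetry of `μ`. -/
theorem subst_avgSeq {μ : NCSeries k (Fin N)} (hμ : μ [] = 0) (hsymm : IsTotallySymmetric μ)
    (σ : Equiv.Perm (Fin (N + 1))) (t : ℕ) (i : Fin (N + 1)) :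
    subst (fun j => letter (σ j)) (avgSeq μ t i) = avgSeq μ t (σ i) := by
  have hl (j : Fin (N + 1)) : (letter (σ j) : NCSeries k (Fin (N + 1))) [] = 0 := letter_nil _
  have h0 (t : ℕ) (i : Fin (N + 1)) : avgSeq μ t i [] = 0 := by
    cases t with
    | zero => exact letter_nil i
    | succ t => rw [avgSeq_succ, subst_nil, hμ]
  induction t generalizing i with
  | zero => exact subst_letter hl i
  | succ t ih =>
    rw [avgSeq_succ, subst_subst hl fun j => h0 t _, avgSeq_succ]
    simp only [ih]
    let τ : Equiv.Perm (Fin N) := (finSuccAboveEquiv i).trans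
      ((σ.subtypeEquiv fun x => by simp).trans (finSuccAboveEquiv (σ i)).symm)
    have hτ (j : Fin N) : (σ i).succAbove (τ j) = σ (i.succAbove j) := by
      have := congrArg Subtype.val ((finSuccAboveEquiv (σ i)).apply_symm_apply
        (σ.subtypeEquiv (fun x => by simp) (finSuccAboveEquiv i j)))
      exact this
    conv_rhs => rw [← congrArg (subst _) (hsymm τ)]
    rw [subst_subst (fun j => h0 t _) fun j => letter_nil _]
    congr 1
    ext1 j
    rw [subst_letter fun j => h0 t _, hτ]

theorem avgStep_singleton {μ : NCSeries k (Fin N)} (hlin : ∀ j, μ [j] = 1 / N)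
    (i l : Fin (N + 1)) : avgStep μ i [l] = if l = i then 0 else 1 / (N : k) := by
  rw [avgStep, subst_singleton fun j => letter_nil _]
  simp only [letter_singleton, hlin]
  split_ifs with h
  · refine Finset.sum_eq_zero fun j _ => ?_
    rw [if_neg (by rw [h]; exact (Fin.succAbove_ne i j).symm), mul_zero]
  · obtain ⟨j, rfl⟩ := Fin.exists_succAbove_eq h
    rw [Finset.sum_eq_single j]
    · rw [if_pos rfl, mul_one]
    · intro j' _ hj'
      rw [if_neg fun e => hj' (Fin.succAbove_right_injective e).symm, mul_zero]
    · simp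

theorem ordGE_two {X : Type*} {f : NCSeries k X} (h0 : f [] = 0) (h1 : ∀ x, f [x] = 0) :
    OrdGE 2 f := by
  rintro (_ | ⟨x, _ | ⟨y, u⟩⟩) hw
  · exact h0
  · exact h1 x
  · simp at hw

theorem TruncTendsto.unique {X : Type*} {u : ℕ → NCSeries k X} {ν ν' : NCSeries k X}
    (h : TruncTendsto u ν) (h' : TruncTendsto u ν') : ν = ν' :=
  NCSeries.ext fun w => tendsto_nhds_unique (truncTendsto_iff.1 h w) (truncTendsto_iff.1 h' w)

theorem _root_.IsAverageSequence.unique {μ μ' : (m : ℕ) → NCSeries k (Fin (m + 2))}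
    (h : IsAverageSequence μ) (h' : IsAverageSequence μ') : μ = μ' := by
  funext m
  induction m with
  | zero => rw [h.start, h'.start]
  | succ m ih =>
    have h1 := h.tendsto m 0
    rw [ih] at h1
    exact TruncTendsto.unique h1 (h'.tendsto m 0)

variable [NormedAlgebra ℚ k]

/-- One step of the construction of the averages: for a symmetric Lie series `μ` whose linear part
is the mean of the letters, the iteration built from `μ` converges, and its limit has the same
properties. On linear parts, the iteration fixes the mean of the letters and multiplies the
deviations from it by `-1 / N`. -/
theorem exists_next_average (hN : 2 ≤ N) {μ : NCSeries k (Fin N)} (hLie : IsLie μ)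
    (hsymm : IsTotallySymmetric μ) (hlin : ∀ j, μ [j] = 1 / N) :
    ∃ ν : NCSeries k (Fin (N + 1)), IsLie ν ∧ IsTotallySymmetric ν ∧
      (∀ j, ν [j] = 1 / ((N + 1 : ℕ) : k)) ∧ ∀ i, TruncTendsto (fun t => avgSeq μ t i) ν := by
  have : CharZero k := algebraRat.charZero k
  have hμ0 := hLie.apply_nil
  have hN0 : (N : k) ≠ 0 := by exact_mod_cast (by omega : N ≠ 0)
  have hN1 : (N : k) + 1 ≠ 0 := by exact_mod_cast Nat.succ_ne_zero N
  set a := avgStep μ with ha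
  have ha0 : ∀ i, a i [] = 0 := avgStep_nil hμ0
  have hamem : ∀ i, a i ∈ primitive k _ := fun i =>
    subst_mem_primitive (fun j => letter_mem_primitive _) hLie
  have ha1 : ∀ i l, a i [l] = if l = i then 0 else 1 / (N : k) := avgStep_singleton hlin
  set s : NCSeries k (Fin (N + 1)) := (1 / ((N : k) + 1)) • ∑ i, letter i with hs
  have hsmem : s ∈ primitive k _ :=
    SMulMemClass.smul_mem _ (sum_mem fun i _ => letter_mem_primitive i)
  have hs1 (l : Fin (N + 1)) : s [l] = 1 / ((N : k) + 1) := by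
    rw [hs, smul_apply, sum_apply]
    simp [letter_singleton]
  have hsEig : IsEigenMod a 1 1 s := by
    refine ⟨ordGE_one_iff.2 hsmem.1, ordGE_two ?_ fun l => ?_⟩
    · rw [sub_apply, subst_nil, smul_apply, hsmem.1, mul_zero, sub_zero]
    · rw [sub_apply, subst_singleton ha0, smul_apply, one_mul, sub_eq_zero]
      simp only [hs1, ha1]
      rw [← Finset.mul_sum, Finset.sum_ite, Finset.sum_const_zero, zero_add, Finset.sum_const,
        Finset.filter_ne, Finset.card_erase_of_mem (Finset.mem_univ l), Finset.card_univ,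
        Fintype.card_fin, nsmul_eq_mul, Nat.add_sub_cancel, mul_one_div_cancel hN0, mul_one]
  have hq : ‖(-1 / N : k)‖ < 1 := by
    have hnorm : ‖(N : k)‖ = N := by
      have := norm_algebraMap' k (N : ℚ)
      rw [map_natCast] at this
      rw [this, ← Rat.norm_cast_real, Rat.cast_natCast, Real.norm_natCast]
    rw [norm_div, norm_neg, norm_one, hnorm, div_lt_one (by exact_mod_cast (by omega : 0 < N))]
    exact_mod_cast hN
  have hyEig (i : Fin (N + 1)) : IsEigenMod a 1 (-1 / N : k) (letter i - s) := by
    have h0 : (letter i - s : NCSeries k (Fin (N + 1))) [] = 0 := by rw [sub_apply, letter_nil, hsmem.1, sub_zero]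
    refine ⟨ordGE_one_iff.2 h0, ordGE_two ?_ fun l => ?_⟩
    · rw [sub_apply, subst_nil, smul_apply, h0, mul_zero, sub_zero]
    · have hsl := hsEig.2 [l] (by simp)
      rw [sub_apply, smul_apply, one_mul, sub_eq_zero] at hsl
      rw [sub_apply, subst_sub, sub_apply, hsl, subst_letter ha0, smul_apply, sub_apply, ha1, hs1,
        letter_singleton]
      split_ifs
      · field_simp; ring
      · field_simp; ring
  obtain ⟨ν, hνs, hν⟩ := exists_tendsto_orbit hamem hsmem hsEig hq hyEig
  have hconv : ∀ i, ∀ w, Tendsto (fun t => avgSeq μ t i w) atTop (𝓝 (ν w)) := fun i w => by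
    simp only [avgSeq_eq hμ0]
    exact hν i w
  have hmem (t : ℕ) (i : Fin (N + 1)) : avgSeq μ t i ∈ primitive k _ := by
    induction t generalizing i with
    | zero => exact letter_mem_primitive i
    | succ t ih => exact subst_mem_primitive (fun j => ih _) hLie
  refine ⟨ν, isLie_of_tendsto (fun t => hmem t 0) (hconv 0), fun σ => NCSeries.ext fun w => ?_,
    fun j => ?_, fun i => truncTendsto_iff.2 (hconv i)⟩
  · refine tendsto_nhds_unique (tendsto_subst _ (hconv 0) w) ((hconv (σ 0) w).congr fun t => ?_)
    rw [subst_avgSeq hμ0 hsymm]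
  · have := hνs [j] (by simp)
    rw [sub_apply, sub_eq_zero] at this
    rw [this, hs1, Nat.cast_succ]

variable (k) in
/-- The type of symmetric Lie series in `m + 2` letters whose linear part is the mean of the letters. -/
def Average (m : ℕ) : Type _ :=
  {μ : NCSeries k (Fin (m + 2)) // IsLie μ ∧ IsTotallySymmetric μ ∧
    ∀ j, μ [j] = 1 / ((m + 2 : ℕ) : k)}

variable (k) in
theorem exists_averages : ∃ μ : (m : ℕ) → Average k m, (μ 0).1 = mu2 k ∧
    ∀ m i, TruncTendsto (fun t => avgSeq (μ m).1 t i) (μ (m + 1)).1 := by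
  have : CharZero k := algebraRat.charZero k
  have hnext (m : ℕ) (μ : Average k m) : ∃ ν : Average k (m + 1),
      ∀ i, TruncTendsto (fun t => avgSeq μ.1 t i) ν.1 := by
    obtain ⟨ν, h1, h2, h3, h4⟩ :=
      exists_next_average (by omega) μ.2.1 μ.2.2.1 μ.2.2.2
    exact ⟨⟨ν, h1, h2, h3⟩, h4⟩
  choose next hnext using hnext
  exact ⟨Nat.rec ⟨mu2 k, isLie_mu2, isTotallySymmetric_mu2, fun j => by
    rw [mu2_singleton]; norm_num⟩ next, rfl, fun m => hnext m _⟩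

end Average

end NCSeries

end

open NCSeries in
theorem lemma4p1 (k : Type*) [NormedField k] [NormedAlgebra ℚ k] :
    (∃! μ : (m : ℕ) → NCSeries k (Fin (m + 2)), IsAverageSequence μ) ∧
      ∀ μ : (m : ℕ) → NCSeries k (Fin (m + 2)), IsAverageSequence μ →
        ∀ m : ℕ, NCSeries.trunc 0 (μ (m + 1))
          = (1 / ((m + 3 : ℕ) : k)) • ∑ i : Fin (m + 3), NCSeries.letter i := by
  obtain ⟨ν, hν0, hν⟩ := exists_averages k
  have h : IsAverageSequence fun m => (ν m).1 :=
    ⟨hν0, fun m => (ν (m + 1)).2.1, fun m => (ν (m + 1)).2.2.1, hν⟩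
  refine ⟨⟨_, h, fun μ hμ => hμ.unique h⟩, fun μ hμ m => ?_⟩
  rw [hμ.unique h]
  ext w
  rw [NCSeries.smul_apply, NCSeries.sum_apply]
  rcases w with _ | ⟨x, _ | ⟨y, u⟩⟩
  · simp [trunc, (ν (m + 1)).2.1.apply_nil, letter_nil]
  · have h3 : (m : k) + 1 + 2 = m + 3 := by ring
    simp [trunc, (ν (m + 1)).2.2.2 x, letter_singleton, h3]
  · simp [trunc, letter]
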